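/- Let $d\ge 1$, $0<s<1$. Write $\hat v(\omega)=(2\pi)^{-d}\int_{\mathbb R^d}v(x)e^{-i\omega\cdot x}\,dx$ (extended to tempered distributions), and $$|u|_{H^t}=\Big((2\pi)^d\int|\omega|^{2t}|\hat u|^2d\omega\Big)^{1/2},\qquad \|v\|_{H^{-s}}=\Big((2\pi)^d\int(1+|\omega|^2)^{-s}|\hat v|^2d\omega\Big)^{1/2}.$$ For an open set $\Omega\subset\mathbb R^d$ let $\widetilde H^t(\Omega)$ be the space of (real- or complex-valued) $u\in H^t(\mathbb R^d)$ with $u=0$ a.e. outside $\Omega$. For $N\in\mathbb N$, $N\ge1$, and $k\in\mathbb Z^d$ let $\varphi^N_k(x)=\prod_{i=1}^d\operatorname{sinc}(Nx_i-k_i)$ with $\operatorname{sinc}(y)=\frac{\sin(\pi y)}{\pi y}$, $\operatorname{sinc}(0)=1$, and let $\Pi_Nv=\sum_{k\in\mathbb Z^d}v(k/N)\,\varphi^N_k$. Mollifiers. Call $\psi:\mathbb R^d\to\mathbb R$ a mollifier of radius $r$ if $\psi\in C_c^\infty(\mathbb R^d)$, $\operatorname{supp}\psi\subset\overline{B_r(0)}$,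 $\psi\ge0$, $\psi(-x)=\psi(x)$ and $\int\psi=1$. Mollifiers $\psi$ of radius $\sqrt d/4$ exist. For every such $\psi$ put $\eta=\chi_{(-1/2,1/2)^d}*\psi$ and $\eta_\varepsilon(x)=\varepsilon^{-d}\eta(x/\varepsilon)$. Then $\eta$ is a mollifier of radius $\sqrt d$ and, for all $\omega\in\mathbb R^d$, $$\int\eta(x)e^{-i\omega\cdot x}dx=\Big(\int\psi(x)e^{-i\omega\cdot x}dx\Big)\prod_{i=1}^d\operatorname{sinc}\Big(\frac{\omega_i}{2\pi}\Big).$$ Error bounds. For every such $\psi$ there is a constant $C>0$ depending only on $d$, $s$ and $\psi$ such that the following holds for every open $\Omega\subset\mathbb R^d$, every $t>s$ and every $u\in\widetilde H^t(\Omega)$. Let $\bar f=(-\Delta)^su$ be the tempered distribution on $\mathbb R^d$ with Fourier transform $\hat f=|\omega|^{2s}\hat u$, and let $\bar f_\varepsilon=\eta_\varepsilon*\bar f$. (i) For every $\varepsilon>0$, $\bar f_\varepsilon\in L^2(\mathbb R^d)$, and if $t-s\le2$, then $$\|\bar f-\bar f_\varepsilon\|_{H^{-s}}\le C\,\varepsilon^{t-s}\,|u|_{H^t}.$$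 (ii) For every integer $N\ge1$ and $\varepsilon=1/N$, the series defining $\Pi_N\bar f_\varepsilon$ converges absolutely at every point, $\bar f_\varepsilon$ and $\Pi_N\bar f_\varepsilon$ lie in $L^2(\mathbb R^d)$, and $$\|\bar f_\varepsilon-\Pi_N\bar f_\varepsilon\|_{H^{-s}}\le C\,\varepsilon^{t-s}\,|u|_{H^t}.$$ -/

import Mathlib

open MeasureTheory Set
open scoped SchwartzMap FourierTransform ContDiff ENNReal Convolution

noncomputable section

namespace SincGalerkin

/-- Euclidean space `ℝ^d`. -/
abbrev E (d : ℕ) : Type := EuclideanSpace ℝ (Fin d)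

/-! ### Sobolev norms

Mathlib's Fourier transform is `𝓕 v ξ = ∫ v x * exp (-2πi ⟨x, ξ⟩) dx`, so the angular frequency is
`ω = 2πξ`. With `v̂ ω = (2π)^(-d) * ∫ v x * exp (-i ⟨x, ω⟩) dx = (2π)^(-d) * 𝓕 v (ω / 2π)`, one has
`(2π)^d * ∫ m(ω) * |v̂ ω|^2 dω = ∫ m(2πξ) * |𝓕 v ξ|^2 dξ` for every weight `m`. -/

/-- The seminorm `|u|_{H^t}`, the square root of `(2π)^d * ∫ |ω|^(2t) * |û ω|^2 dω`. -/
def sobolevSeminorm {d : ℕ} (t : ℝ) (u : Lp ℂ 2 (volume : Measure (E d))) : ℝ≥0∞ :=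
  eLpNorm (fun ξ : E d => ((‖(2 * Real.pi) • ξ‖ ^ t : ℝ) : ℂ) * (𝓕 u) ξ) 2 volume

/-- The weight `(1 + |ω|^2)^(σ/2)` at `ω = 2πξ`. -/
def sobolevWeight {d : ℕ} (σ : ℝ) (ξ : E d) : ℂ :=
  (((1 + ‖(2 * Real.pi) • ξ‖ ^ 2) ^ (σ / 2) : ℝ) : ℂ)

theorem sobolevWeight_hasTemperateGrowth {d : ℕ} (σ : ℝ) :
    (sobolevWeight (d := d) σ).HasTemperateGrowth := by
  have h : Function.HasTemperateGrowth (fun x : E d => (((1 + ‖x‖^2)^(σ/2) : ℝ) : ℂ)) := by fun_prop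
  have h2 : Function.HasTemperateGrowth (fun x : E d => (2*Real.pi) • x) := by
    exact ((2*Real.pi) • ContinuousLinearMap.id ℝ (E d)).hasTemperateGrowth
  exact h.comp h2

/-- The (inhomogeneous) norm of a tempered distribution `T` in `H^σ(ℝ^d)`: the `L²` norm of
`(1 + |ω|^2)^(σ/2) * T̂` if this tempered distribution is given by a function `g ∈ L²` (which is
then unique), and `∞` if it is not. -/
def sobolevNorm {d : ℕ} (σ : ℝ) (T : 𝓢'(E d, ℂ)) : ℝ≥0∞ :=
  ⨅ (g : Lp ℂ 2 (volume : Measure (E d)))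
    (_ : TemperedDistribution.smulLeftCLM ℂ (sobolevWeight σ) (𝓕 T) = (g : 𝓢'(E d, ℂ))), ‖g‖ₑ

/-- `u ∈ H̃^t(Ω)`: `u` belongs to `H^t(ℝ^d)` and vanishes (almost everywhere) outside `Ω`. -/
def MemHTilde {d : ℕ} (Ω : Set (E d)) (t : ℝ) (u : Lp ℂ 2 (volume : Measure (E d))) : Prop :=
  TemperedDistribution.MemSobolev t 2 (u : 𝓢'(E d, ℂ)) ∧
    ∀ᵐ x ∂(volume : Measure (E d)), x ∉ Ω → u x = 0

/-- `f = (-Δ)^s u` on all of `ℝ^d`, that is, the Fourier transform of the tempered distribution `f`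
is the function `|ω|^(2s) * û`. -/
def IsFracLaplacian {d : ℕ} (s : ℝ) (u : Lp ℂ 2 (volume : Measure (E d))) (f : 𝓢'(E d, ℂ)) :
    Prop :=
  ∀ φ : 𝓢(E d, ℂ),
    (𝓕 f) φ = ∫ ξ, φ ξ * (((‖(2 * Real.pi) • ξ‖ ^ (2 * s) : ℝ) : ℂ) * (𝓕 u) ξ)

/-- The distribution `(-Δ)^s u` exists and is unique for every `u ∈ L²`. -/
theorem existsUnique_isFracLaplacian {d : ℕ} (s : ℝ) (hs : 0 < s) (u : Lp ℂ 2 (volume : Measure (E d))) :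
    ∃! f, IsFracLaplacian s u f := by
  let m : E d → ℂ := fun ξ => ((‖(2 * Real.pi) • ξ‖ ^ (2 * s) : ℝ) : ℂ)
  have hw : ∀ ξ : E d, sobolevWeight (2*s) ξ ≠ 0 := by
    intro ξ; unfold sobolevWeight; norm_cast; positivity
  let b : E d → ℂ := fun ξ => (sobolevWeight (2*s) ξ)⁻¹ * (m ξ * (𝓕 u) ξ)
  have hb : MemLp b 2 volume := by
    refine (Lp.memLp (𝓕 u)).of_le ?_ ?_
    · refine AEStronglyMeasurable.mul ?_ (AEStronglyMeasurable.mul ?_ (Lp.aestronglyMeasurable _))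
      · refine Measurable.aestronglyMeasurable ?_
        unfold sobolevWeight; fun_prop
      · refine Measurable.aestronglyMeasurable ?_
        fun_prop
    · refine Filter.Eventually.of_forall fun ξ => ?_
      simp only [b, m, norm_mul, norm_inv, ← mul_assoc]
      refine mul_le_of_le_one_left (norm_nonneg _) ?_
      rw [inv_mul_le_one₀ (norm_pos_iff.mpr (hw ξ))]
      unfold sobolevWeight
      rw [Complex.norm_of_nonneg (by positivity), Complex.norm_of_nonneg (by positivity),
        Real.rpow_mul (by positivity) 2 s, show 2*s/2 = s by ring]
      refine Real.rpow_le_rpow (by positivity) ?_ hs.le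
      norm_num
  refine ⟨𝓕⁻ (TemperedDistribution.smulLeftCLM ℂ (sobolevWeight (2*s)) (hb.toLp b : 𝓢'(E d, ℂ))), ?_, ?_⟩
  · intro φ
    rw [FourierTransform.fourier_fourierInv_eq, TemperedDistribution.smulLeftCLM_apply_apply, Lp.toTemperedDistribution_apply]
    refine integral_congr_ae ?_
    filter_upwards [hb.coeFn_toLp] with ξ h
    rw [h, SchwartzMap.smulLeftCLM_apply_apply (sobolevWeight_hasTemperateGrowth _)]
    have := hw ξ
    simp only [b, smul_eq_mul, m]
    field_simp
  · intro g hg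
    have : 𝓕 g = TemperedDistribution.smulLeftCLM ℂ (sobolevWeight (2*s)) (hb.toLp b : 𝓢'(E d, ℂ)) := by
      ext φ
      rw [hg φ, TemperedDistribution.smulLeftCLM_apply_apply, Lp.toTemperedDistribution_apply]
      refine integral_congr_ae ?_
      filter_upwards [hb.coeFn_toLp] with ξ h
      rw [h, SchwartzMap.smulLeftCLM_apply_apply (sobolevWeight_hasTemperateGrowth _)]
      have := hw ξ
      simp only [b, smul_eq_mul, m]
      field_simp
    rw [← this, FourierTransform.fourierInv_fourier_eq]

/-! ### Mollifiers -/

/-- A standard mollifier supported in the closed ball of radius `r` about the origin: smooth,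
nonnegative, symmetric and of integral one. -/
structure IsMollifier {d : ℕ} (r : ℝ) (ψ : E d → ℝ) : Prop where
  contDiff : ContDiff ℝ ∞ ψ
  tsupport_subset : tsupport ψ ⊆ Metric.closedBall 0 r
  nonneg : ∀ x, 0 ≤ ψ x
  symm : ∀ x, ψ (-x) = ψ x
  integral_eq_one : ∫ x, ψ x = 1

/-- The indicator function of the cube `(-1/2, 1/2)^d`. -/
def cubeIndicator (d : ℕ) : E d → ℝ :=
  indicator {x | ∀ i, x i ∈ Ioo (-(1 / 2) : ℝ) (1 / 2)} 1

/-- The mollifier `η`, the convolution of the indicator of the cube `(-1/2, 1/2)^d` with `ψ`: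
`η x = ∫ cubeIndicator y * ψ (x - y) dy`. -/
def sincMollifier {d : ℕ} (ψ : E d → ℝ) : E d → ℝ :=
  cubeIndicator d ⋆[ContinuousLinearMap.lsmul ℝ ℝ, volume] ψ

/-- The transform `η̂ w = ∫ η x * exp (-i ⟨w, x⟩) dx`. With this normalization the transform
of `ε^(-d) * η (x / ε)` at `w` is `η̂ (ε w)`, and `η̂ 0 = ∫ η`. -/
def angularFourier {d : ℕ} (η : E d → ℝ) (w : E d) : ℂ :=
  ∫ x, Complex.exp (-(Complex.I * ((inner ℝ w x : ℝ) : ℂ))) * (η x : ℂ)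

theorem IsMollifier.hasCompactSupport {d : ℕ} {r : ℝ} {ψ : E d → ℝ} (hψ : IsMollifier r ψ) :
    HasCompactSupport ψ :=
  (isCompact_closedBall (0 : E d) r).of_isClosed_subset (isClosed_tsupport ψ) hψ.tsupport_subset

theorem isOpen_cube (d : ℕ) :
    IsOpen {x : E d | ∀ i, x i ∈ Ioo (-(1 / 2) : ℝ) (1 / 2)} := by
  simp only [ofPred_forall]
  exact isOpen_iInter_of_finite fun i =>
    isOpen_Ioo.preimage (by fun_prop : Continuous fun x : E d => x i)

theorem cubeIndicator_hasCompactSupport (d : ℕ) : HasCompactSupport (cubeIndicator d) := by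
  refine HasCompactSupport.intro
    (isCompact_closedBall (0 : E d) (Real.sqrt (∑ _i : Fin d, (1 : ℝ)))) fun x hx => ?_
  refine indicator_of_notMem (fun h => hx ?_) _
  rw [mem_closedBall_zero_iff, EuclideanSpace.norm_eq]
  refine Real.sqrt_le_sqrt (Finset.sum_le_sum fun i _ => ?_)
  obtain ⟨h1, h2⟩ := h i
  rw [Real.norm_eq_abs, sq_abs]
  nlinarith

theorem cubeIndicator_locallyIntegrable (d : ℕ) :
    LocallyIntegrable (cubeIndicator d) (volume : Measure (E d)) := by
  have h : LocallyIntegrable (fun _ : E d => (1 : ℝ)) volume := locallyIntegrable_const 1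
  exact h.indicator (isOpen_cube d).measurableSet

theorem sincMollifier_contDiff {d : ℕ} {r : ℝ} {ψ : E d → ℝ} (hψ : IsMollifier r ψ) :
    ContDiff ℝ ∞ (sincMollifier ψ) :=
  hψ.hasCompactSupport.contDiff_convolution_right _ (cubeIndicator_locallyIntegrable d)
    hψ.contDiff

theorem sincMollifier_hasCompactSupport {d : ℕ} {r : ℝ} {ψ : E d → ℝ} (hψ : IsMollifier r ψ) :
    HasCompactSupport (sincMollifier ψ) :=
  HasCompactSupport.convolution (μ := volume) (L := ContinuousLinearMap.lsmul ℝ ℝ)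
    (cubeIndicator_hasCompactSupport d) hψ.hasCompactSupport

/-- The scaled mollifier `η_ε x = ε^(-d) * η (x / ε)`, with complex values. -/
def scaled {d : ℕ} (η : E d → ℝ) (ε : ℝ) (x : E d) : ℂ :=
  (((ε ^ d)⁻¹ * η (ε⁻¹ • x) : ℝ) : ℂ)

theorem scaled_sub_contDiff {d : ℕ} {η : E d → ℝ} (h : ContDiff ℝ ∞ η) (ε : ℝ) (x : E d) :
    ContDiff ℝ ∞ (fun y => scaled η ε (x - y)) := by
  unfold scaled
  exact Complex.ofRealCLM.contDiff.comp
    (contDiff_const.mul (h.comp (by fun_prop)))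

theorem scaled_sub_hasCompactSupport {d : ℕ} {η : E d → ℝ} (h : HasCompactSupport η) {ε : ℝ}
    (hε : 0 < ε) (x : E d) : HasCompactSupport (fun y => scaled η ε (x - y)) := by
  have h1 : HasCompactSupport (fun y => η (ε⁻¹ • (x - y))) :=
    h.comp_homeomorph ((Homeomorph.subLeft x).trans
      (Homeomorph.smulOfNeZero ε⁻¹ (inv_pos.mpr hε).ne'))
  exact (h1.mul_left (f := fun _ => (ε ^ d)⁻¹)).comp_left (g := fun r : ℝ => (r : ℂ))
    Complex.ofReal_zero

/-- The test function `y ↦ η_ε (x - y)`, where `η` is the mollifier built from `ψ`. -/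
def mollifierAt {d : ℕ} {r : ℝ} {ψ : E d → ℝ} (hψ : IsMollifier r ψ) {ε : ℝ} (hε : 0 < ε)
    (x : E d) : 𝓢(E d, ℂ) :=
  (scaled_sub_hasCompactSupport (sincMollifier_hasCompactSupport hψ) hε x).toSchwartzMap
    (scaled_sub_contDiff (sincMollifier_contDiff hψ) ε x)

/-- The function `f_ε = η_ε * f`, for a tempered distribution `f`:
`f_ε x` is `f` applied to `y ↦ η_ε (x - y)`. -/
def mollify {d : ℕ} {r : ℝ} {ψ : E d → ℝ} (hψ : IsMollifier r ψ) {ε : ℝ} (hε : 0 < ε)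
    (f : 𝓢'(E d, ℂ)) (x : E d) : ℂ :=
  f (mollifierAt hψ hε x)

/-! ### Sinc interpolation -/

/-- The mesh width `h = 1 / N`. -/
def meshWidth (N : ℕ) : ℝ := 1 / N

theorem meshWidth_pos {N : ℕ} (hN : 0 < N) : 0 < meshWidth N :=
  one_div_pos.mpr (Nat.cast_pos.mpr hN)

/-- The basis function `φ^N_k x = ∏ i, sinc (N * x i - k i)` with `sinc y = sin (π y) / (π y)`. -/
def sincBasis {d : ℕ} (N : ℕ) (k : Fin d → ℤ) (x : E d) : ℝ :=
  ∏ i, Real.sinc (Real.pi * (N * x i - k i))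

/-- The grid point `k / N`. -/
def gridPoint {d : ℕ} (N : ℕ) (k : Fin d → ℤ) : E d :=
  WithLp.toLp 2 fun i => (k i : ℝ) / N

/-- The sinc interpolant `Π_N v x = ∑ k ∈ ℤ^d, v (k / N) * φ^N_k x`. -/
def sincInterp {d : ℕ} (N : ℕ) (v : E d → ℂ) (x : E d) : ℂ :=
  ∑' k : Fin d → ℤ, v (gridPoint N k) * (sincBasis N k x : ℂ)

end SincGalerkin

end

namespace SincGalerkin

open scoped Pointwise

/-! ### Integrals of exponentials over cubes -/

/-! Everything is proved on the Fourier side. With `ω = 2πξ`, the mollified distribution has symbol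
`h = η̂(εω) |ω|^(2s) û`, where `η̂ = ψ̂ · ∏ sinc`. Both bounds use that the weight `(1 +
|ω|²)^(-s/2)` absorbs one factor `|ω|^s`, leaving `|ω|^s |û|`, to be compared with `|ω|^t |û|`.

Mollification error: its symbol is `(1 - η̂(εω)) |ω|^(2s) û`. Since `η` is even with integral one
and compact support, `|1 - η̂|` is at most quadratic at the origin, and it is bounded; hence `|1 -
η̂(w)| ≤ c |w|^a` for all `0 ≤ a ≤ 2`, with `c` independent of `a`. Taking `a = t - s` gives the
rate (`IsMollifier.norm_one_sub_fourier_le`).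

Interpolation error: on the grid `ℤ^d / N` the exponentials do not distinguish frequencies differing
by `N ℤ^d`, so samples only see the periodization of `h`; Parseval on the torus identifies sinc
interpolation with cutting that periodization to the central cell (`hasSum_sincInterp_fourierInv`).
The error symbol is therefore `h` outside the cell and minus the sum of the aliases `h(ξ + N m)`, `m
≠ 0`, inside. Outside, `|η̂| ≤ 1` and `|ω| ≥ N` give the rate at once.

Inside the cell the weight sits at `ξ`, while the growth `|ω|^(2s)` sits at the possibly much larger
frequency `ξ + N m`. This is why `η` contains the indicator of the cube: the sinc factors vanish at
nonzero lattice points, so `η̂(ζ + m)` is at most `2 |ζ|^s |ψ̂(ζ + m)|`. The factor `|ζ|^s` pays for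
the weight near `ξ = 0`, and the Schwartz decay of `ψ̂` absorbs one power `|ζ + m|^s` and still
leaves a square-summable factor (`mul_norm_alias_le`). Cauchy–Schwarz in `m` and unfolding the cell
integral reduce the rest to the high-frequency part of `|ω|^s |û|`, of size `N^(-(t-s)) |u|_{H^t}`.
-/

theorem inner_eq_sum {d : ℕ} (x y : E d) : inner ℝ x y = ∑ i, x i * y i := by
  simp [PiLp.inner_apply, mul_comm]

theorem setIntegral_cube_prod {d : ℕ} (S : Set ℝ) (g : Fin d → ℝ → ℂ) :
    ∫ x : E d in {x | ∀ i, x i ∈ S}, ∏ i, g i (x i) = ∏ i, ∫ t in S, g i t := by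
  have h := (PiLp.volume_preserving_toLp (Fin d)).setIntegral_preimage_emb
    (MeasurableEquiv.toLp 2 (Fin d → ℝ)).measurableEmbedding
    (fun x : E d => ∏ i, g i (x i)) {x | ∀ i, x i ∈ S}
  rw [← h]
  have hs : WithLp.toLp 2 ⁻¹' {x : E d | ∀ i, x i ∈ S} = univ.pi fun _ : Fin d => S := by
    ext x; simp
  rw [hs, volume_pi, Measure.restrict_pi_pi]
  exact integral_fintype_prod_eq_prod g

theorem setIntegral_cube_exp {d : ℕ} (S : Set ℝ) (y : E d) :
    ∫ x : E d in {x | ∀ i, x i ∈ S}, Complex.exp (((2 * Real.pi * inner ℝ x y : ℝ) : ℂ) * Complex.I)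
      = ∏ i, ∫ t in S, Complex.exp (((2 * Real.pi * (t * y i) : ℝ) : ℂ) * Complex.I) := by
  rw [← setIntegral_cube_prod]
  congr with x
  rw [← Complex.exp_sum, inner_eq_sum, Finset.mul_sum]
  push_cast
  rw [Finset.sum_mul]

theorem setIntegral_Ioc_exp (a : ℝ) :
    ∫ t in Ioc (-(1 / 2) : ℝ) (1 / 2), Complex.exp (((2 * Real.pi * (t * a) : ℝ) : ℂ) * Complex.I)
      = Real.sinc (Real.pi * a) := by
  rw [← intervalIntegral.integral_of_le (by norm_num)]
  rcases eq_or_ne a 0 with rfl | ha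
  · norm_num
  have hc : (2 * Real.pi * a : ℂ) * Complex.I ≠ 0 := by
    simp [ha, Real.pi_ne_zero]
  have h := integral_exp_mul_complex (a := -(1 / 2)) (b := 1 / 2) hc
  have e : ∀ t : ℝ, Complex.exp (((2 * Real.pi * (t * a) : ℝ) : ℂ) * Complex.I)
      = Complex.exp ((2 * Real.pi * a : ℂ) * Complex.I * t) := by
    intro t; congr 1; push_cast; ring
  simp_rw [e]
  rw [h, Real.sinc_of_ne_zero (by positivity)]
  push_cast
  rw [Complex.sin]
  have hI := Complex.I_ne_zero
  have hp : (Real.pi : ℂ) ≠ 0 := by exact_mod_cast Real.pi_ne_zero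
  have ha' : (a : ℂ) ≠ 0 := by exact_mod_cast ha
  have e1 : (2 * Real.pi * a : ℂ) * Complex.I * (1 / 2) = Real.pi * a * Complex.I := by ring
  have e2 : (2 * Real.pi * a : ℂ) * Complex.I * (-(1 / 2)) = -(Real.pi * a) * Complex.I := by ring
  rw [e1, e2]
  field_simp
  rw [Complex.I_sq]
  ring

theorem setIntegral_unitCube_exp {d : ℕ} (y : E d) :
    ∫ x : E d in {x | ∀ i, x i ∈ Ioc (-(1 / 2) : ℝ) (1 / 2)},
        Complex.exp (((2 * Real.pi * inner ℝ x y : ℝ) : ℂ) * Complex.I)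
      = ∏ i, ((Real.sinc (Real.pi * y i) : ℝ) : ℂ) := by
  rw [setIntegral_cube_exp]
  exact Finset.prod_congr rfl fun i _ => setIntegral_Ioc_exp _

/-! ### Mollifiers -/

theorem exists_isMollifier (d : ℕ) {r : ℝ} (hr : 0 < r) : ∃ ψ : E d → ℝ, IsMollifier r ψ := by
  let b : ContDiffBump (0 : E d) := ⟨r / 2, r, by positivity, by linarith⟩
  refine ⟨b.normed volume, b.contDiff_normed, ?_, b.nonneg_normed, b.normed_neg,
    b.integral_normed⟩
  rw [b.tsupport_normed_eq]

theorem IsMollifier.integrable {d : ℕ} {r : ℝ} {ψ : E d → ℝ} (hψ : IsMollifier r ψ) :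
    Integrable ψ :=
  hψ.contDiff.continuous.integrable_of_hasCompactSupport hψ.hasCompactSupport

theorem cubeIndicator_integrable (d : ℕ) : Integrable (cubeIndicator d) := by
  have h := (cubeIndicator_locallyIntegrable d).integrableOn_isCompact
    (cubeIndicator_hasCompactSupport d)
  exact (integrableOn_iff_integrable_of_support_subset (subset_tsupport _)).1 h

/-- The transform factorizes over coordinates; its zeros at nonzero integer lattice points are what
suppresses aliasing later. -/
theorem fourier_cubeIndicator {d : ℕ} (ξ : E d) :
    𝓕 (fun x => (cubeIndicator d x : ℂ)) ξ = ∏ i, ((Real.sinc (Real.pi * ξ i) : ℝ) : ℂ) := by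
  rw [Real.fourier_eq']
  have h : ∀ x : E d, Complex.exp (((-2 * Real.pi * inner ℝ x ξ : ℝ) : ℂ) * Complex.I) •
      (cubeIndicator d x : ℂ) = indicator {x : E d | ∀ i, x i ∈ Ioo (-(1 / 2) : ℝ) (1 / 2)}
        (fun x => Complex.exp (((2 * Real.pi * inner ℝ x (-ξ) : ℝ) : ℂ) * Complex.I)) x := by
    intro x
    by_cases hx : x ∈ {x : E d | ∀ i, x i ∈ Ioo (-(1 / 2) : ℝ) (1 / 2)}
    · rw [cubeIndicator, indicator_of_mem hx, indicator_of_mem hx]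
      simp
    · rw [cubeIndicator, indicator_of_notMem hx, indicator_of_notMem hx]
      simp
  simp_rw [h]
  rw [integral_indicator (isOpen_cube d).measurableSet, setIntegral_cube_exp]
  refine Finset.prod_congr rfl fun i _ => ?_
  rw [← integral_Ioc_eq_integral_Ioo, setIntegral_Ioc_exp]
  simp [Real.sinc_neg]

theorem integral_cubeIndicator (d : ℕ) : ∫ x, cubeIndicator d x = 1 := by
  have h := fourier_cubeIndicator (0 : E d)
  rw [Real.fourier_eq'] at h
  simp only [inner_zero_right, mul_zero, Complex.ofReal_zero, zero_mul, Complex.exp_zero,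
    one_smul, PiLp.zero_apply, Real.sinc_zero, Complex.ofReal_one, Finset.prod_const_one] at h
  rw [integral_complex_ofReal] at h
  exact_mod_cast h

theorem cubeIndicator_neg {d : ℕ} (x : E d) : cubeIndicator d (-x) = cubeIndicator d x := by
  unfold cubeIndicator
  have h : (-x ∈ {x : E d | ∀ i, x i ∈ Ioo (-(1 / 2) : ℝ) (1 / 2)}) ↔
      x ∈ {x : E d | ∀ i, x i ∈ Ioo (-(1 / 2) : ℝ) (1 / 2)} := by
    simp only [mem_ofPred_eq, PiLp.neg_apply, mem_Ioo]
    exact forall_congr' fun i => ⟨fun ⟨a, b⟩ => ⟨by linarith, by linarith⟩,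
      fun ⟨a, b⟩ => ⟨by linarith, by linarith⟩⟩
  by_cases hx : x ∈ {x : E d | ∀ i, x i ∈ Ioo (-(1 / 2) : ℝ) (1 / 2)}
  · rw [indicator_of_mem hx, indicator_of_mem (h.2 hx)]; rfl
  · rw [indicator_of_notMem hx, indicator_of_notMem (fun h' => hx (h.1 h'))]

theorem sincMollifier_apply {d : ℕ} (ψ : E d → ℝ) (x : E d) :
    sincMollifier ψ x = ∫ y, cubeIndicator d y * ψ (x - y) := by
  simp [sincMollifier, convolution_def]

theorem norm_le_of_mem_cube {d : ℕ} {x : E d} {a : ℝ} (ha : 0 ≤ a) (hx : ∀ i, |x i| ≤ a) :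
    ‖x‖ ≤ Real.sqrt d * a := by
  rw [EuclideanSpace.norm_eq, ← Real.sqrt_sq ha, ← Real.sqrt_mul (by positivity)]
  refine Real.sqrt_le_sqrt ?_
  calc ∑ i, ‖x i‖ ^ 2 ≤ ∑ _i : Fin d, a ^ 2 :=
        Finset.sum_le_sum fun i _ => pow_le_pow_left₀ (norm_nonneg _) (hx i) 2
    _ = d * a ^ 2 := by simp

theorem IsMollifier.sincMollifier {d : ℕ} {ψ : E d → ℝ}
    (hψ : IsMollifier (Real.sqrt d / 4) ψ) : IsMollifier (Real.sqrt d) (sincMollifier ψ) where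
  contDiff := sincMollifier_contDiff hψ
  tsupport_subset := by
    refine closure_minimal ((support_convolution_subset _).trans ?_) Metric.isClosed_closedBall
    rintro _ ⟨y, hy, z, hz, rfl⟩
    have hz' := hψ.tsupport_subset (subset_closure hz)
    rw [mem_closedBall_zero_iff] at hz' ⊢
    have hy' : ‖y‖ ≤ Real.sqrt d * (1 / 2) := by
      refine norm_le_of_mem_cube (by norm_num) fun i => ?_
      have := (support_indicator_subset hy : y ∈ {x : E d | ∀ i, x i ∈ Ioo (-(1 / 2) : ℝ) (1 / 2)}) i
      exact abs_le.2 ⟨this.1.le, this.2.le⟩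
    -- The radii add up to `√d / 2 + √d / 4`, below `√d`.
    have := Real.sqrt_nonneg (d : ℝ)
    calc ‖y + z‖ ≤ ‖y‖ + ‖z‖ := norm_add_le _ _
      _ ≤ Real.sqrt d := by linarith
  nonneg x := by
    rw [sincMollifier_apply]
    exact integral_nonneg fun y =>
      mul_nonneg (indicator_nonneg (fun _ _ => zero_le_one) _) (hψ.nonneg _)
  symm x := by
    rw [sincMollifier_apply, sincMollifier_apply, ← integral_neg_eq_self]
    refine integral_congr_ae (Filter.Eventually.of_forall fun y => ?_)
    simp only
    rw [cubeIndicator_neg, ← hψ.symm (x - y)]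
    congr 2; abel
  integral_eq_one := by
    unfold SincGalerkin.sincMollifier
    rw [integral_convolution _ (cubeIndicator_integrable d) hψ.integrable,
      integral_cubeIndicator, hψ.integral_eq_one]
    simp

theorem fourier_sincMollifier {d : ℕ} {r : ℝ} {ψ : E d → ℝ} (hψ : IsMollifier r ψ) (ξ : E d) :
    𝓕 (fun x => (sincMollifier ψ x : ℂ)) ξ =
      𝓕 (fun x => (ψ x : ℂ)) ξ * ∏ i, ((Real.sinc (Real.pi * ξ i) : ℝ) : ℂ) := by
  have h := Real.fourier_mul_convolution_eq (cubeIndicator_integrable d).ofReal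
    (hψ.integrable.ofReal (𝕜 := ℂ)) ξ
  rw [← fourier_cubeIndicator, mul_comm]
  refine Eq.trans (congrArg (fun g : E d → ℂ => 𝓕 g ξ) (funext fun x => ?_)) h
  rw [sincMollifier_apply, convolution_def, ← integral_complex_ofReal]
  simp

theorem angularFourier_eq {d : ℕ} (η : E d → ℝ) (w : E d) :
    angularFourier η w = 𝓕 (fun x => (η x : ℂ)) ((2 * Real.pi)⁻¹ • w) := by
  rw [Real.fourier_eq', angularFourier]
  congr with x
  rw [inner_smul_right, real_inner_comm, smul_eq_mul]
  congr 2
  have : (Real.pi : ℂ) ≠ 0 := by exact_mod_cast Real.pi_ne_zero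
  push_cast
  field_simp

theorem angularFourier_sincMollifier {d : ℕ} {r : ℝ} {ψ : E d → ℝ} (hψ : IsMollifier r ψ)
    (w : E d) : angularFourier (sincMollifier ψ) w =
      angularFourier ψ w * ∏ i, ((Real.sinc (w i / 2) : ℝ) : ℂ) := by
  rw [angularFourier_eq, angularFourier_eq, fourier_sincMollifier hψ]
  congr with i
  congr 2
  have := Real.pi_ne_zero
  simp
  field_simp

/-! ### Bounds for the Fourier transform of a mollifier -/

theorem IsMollifier.norm_fourier_le_one {d : ℕ} {r : ℝ} {η : E d → ℝ} (hη : IsMollifier r η)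
    (ξ : E d) : ‖𝓕 (fun x => (η x : ℂ)) ξ‖ ≤ 1 := by
  refine (VectorFourier.norm_fourierIntegral_le_integral_norm _ _ _ _ _).trans ?_
  rw [← hη.integral_eq_one]
  refine (integral_congr_ae (Filter.Eventually.of_forall fun x => ?_)).le
  simp [abs_of_nonneg (hη.nonneg x)]

theorem IsMollifier.continuous_fourier {d : ℕ} {r : ℝ} {η : E d → ℝ} (hη : IsMollifier r η) :
    Continuous (𝓕 (fun x => (η x : ℂ))) :=
  VectorFourier.fourierIntegral_continuous Real.continuous_fourierChar
    (by exact continuous_inner) hη.integrable.ofReal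

/-- Taylor's bound covers `|y| ≤ 1`; for larger `y` the trivial bound `2 |y|` is below `2 y²`, which
fixes the constant. -/
theorem norm_exp_sub_one_sub_le (y : ℝ) :
    ‖Complex.exp (y * Complex.I) - 1 - y * Complex.I‖ ≤ 2 * y ^ 2 := by
  by_cases hy : |y| ≤ 1
  · have := Complex.norm_exp_sub_one_sub_id_le (x := y * Complex.I) (by simpa using hy)
    simp only [Complex.norm_mul, Complex.norm_I, Complex.norm_real, mul_one, Real.norm_eq_abs,
      sq_abs] at this
    nlinarith [sq_nonneg y]
  · push Not at hy
    have h1 : ‖Complex.exp (y * Complex.I) - 1‖ ≤ |y| := by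
      simpa [mul_comm] using Real.norm_exp_I_mul_ofReal_sub_one_le (x := y)
    calc _ ≤ ‖Complex.exp (y * Complex.I) - 1‖ + ‖(y : ℂ) * Complex.I‖ := norm_sub_le _ _
      _ ≤ |y| + |y| := by
          refine add_le_add h1 ?_
          simp
      _ ≤ 2 * y ^ 2 := by rw [← sq_abs]; nlinarith

/-- Symmetry of `η` kills the first-order Taylor term of the exponential under the integral, leaving
the quadratic remainder on a support of radius `r`. -/
theorem IsMollifier.norm_one_sub_fourier_le_sq {d : ℕ} {r : ℝ} {η : E d → ℝ}
    (hη : IsMollifier r η) (ξ : E d) :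
    ‖1 - 𝓕 (fun x => (η x : ℂ)) ξ‖ ≤ 2 * r ^ 2 * ‖(2 * Real.pi) • ξ‖ ^ 2 := by
  set y : E d → ℝ := fun x => -2 * Real.pi * inner ℝ x ξ with hy
  have hyc : Continuous y := by fun_prop
  have hint : ∀ g : E d → ℂ, Continuous g → Integrable fun x => g x * (η x : ℂ) := by
    intro g hg
    refine Continuous.integrable_of_hasCompactSupport
      (hg.mul (Complex.continuous_ofReal.comp hη.contDiff.continuous)) ?_
    exact (hη.hasCompactSupport.comp_left (g := fun r : ℝ => (r : ℂ)) Complex.ofReal_zero).mul_left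
  have i1 : Integrable fun x => Complex.exp (y x * Complex.I) * (η x : ℂ) :=
    hint _ (by fun_prop)
  have i2 : Integrable fun x => (1 : ℂ) * (η x : ℂ) := hint _ continuous_const
  have i3 : Integrable fun x => (y x * Complex.I : ℂ) * (η x : ℂ) := hint _ (by fun_prop)
  have odd : ∫ x, (y x * Complex.I : ℂ) * (η x : ℂ) = 0 := by
    have h := integral_neg_eq_self (fun x => (y x * Complex.I : ℂ) * (η x : ℂ)) volume
    have h2 : ∀ x, (y (-x) * Complex.I : ℂ) * (η (-x) : ℂ) =
        -((y x * Complex.I : ℂ) * (η x : ℂ)) := by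
      intro x
      rw [hη.symm]
      simp [hy]
    simp_rw [h2] at h
    rw [integral_neg] at h
    exact self_eq_neg.1 h.symm
  have one : ∫ x, (1 : ℂ) * (η x : ℂ) = 1 := by
    simp_rw [one_mul]
    rw [integral_complex_ofReal, hη.integral_eq_one, Complex.ofReal_one]
  have key : 𝓕 (fun x => (η x : ℂ)) ξ - 1 =
      ∫ x, (Complex.exp (y x * Complex.I) - 1 - y x * Complex.I) * (η x : ℂ) := by
    simp_rw [sub_mul]
    rw [integral_sub (f := fun x => Complex.exp (y x * Complex.I) * (η x : ℂ) - 1 * (η x : ℂ))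
      (i1.sub i2) i3, integral_sub i1 i2, odd, one, sub_zero, Real.fourier_eq']
    rfl
  rw [norm_sub_rev, key]
  calc _ ≤ ∫ x, (2 * r ^ 2 * ‖(2 * Real.pi) • ξ‖ ^ 2) * η x := by
        refine norm_integral_le_of_norm_le (hη.integrable.const_mul _)
          (Filter.Eventually.of_forall fun x => ?_)
        rw [norm_mul, Complex.norm_real, Real.norm_of_nonneg (hη.nonneg x)]
        by_cases hx : η x = 0
        · simp [hx]
        refine mul_le_mul_of_nonneg_right ((norm_exp_sub_one_sub_le _).trans ?_) (hη.nonneg x)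
        have hxr : ‖x‖ ≤ r := by
          simpa using hη.tsupport_subset (subset_tsupport _ hx)
        have : |y x| ≤ r * ‖(2 * Real.pi) • ξ‖ := by
          have e : y x = -inner ℝ x ((2 * Real.pi) • ξ) := by
            rw [inner_smul_right]; simp only [hy]; ring
          rw [e, abs_neg]
          exact (abs_real_inner_le_norm _ _).trans
            (mul_le_mul_of_nonneg_right hxr (norm_nonneg _))
        calc 2 * y x ^ 2 = 2 * |y x| ^ 2 := by rw [sq_abs]
          _ ≤ 2 * (r * ‖(2 * Real.pi) • ξ‖) ^ 2 := by gcongr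
          _ = _ := by ring
    _ = _ := by rw [integral_const_mul, hη.integral_eq_one, mul_one]

/-- The quadratic bound serves where `|ω| ≤ 1`, the trivial bound `2` elsewhere. The constant does
not depend on `a`, which makes the final constant uniform in `t`. -/
theorem IsMollifier.norm_one_sub_fourier_le {d : ℕ} {r : ℝ} {η : E d → ℝ}
    (hη : IsMollifier r η) {a : ℝ} (ha0 : 0 ≤ a) (ha2 : a ≤ 2) (ξ : E d) :
    ‖1 - 𝓕 (fun x => (η x : ℂ)) ξ‖ ≤ (2 + 2 * r ^ 2) * ‖(2 * Real.pi) • ξ‖ ^ a := by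
  set z := ‖(2 * Real.pi) • ξ‖ with hz
  have hz0 : 0 ≤ z := norm_nonneg _
  rcases le_total 1 z with h | h
  · have h1 : 1 ≤ z ^ a := Real.one_le_rpow h ha0
    calc _ ≤ ‖(1 : ℂ)‖ + ‖𝓕 (fun x => (η x : ℂ)) ξ‖ := norm_sub_le _ _
      _ ≤ 2 := by have := hη.norm_fourier_le_one ξ; norm_num; linarith
      _ ≤ _ := by nlinarith [sq_nonneg r]
  · have h1 : z ^ 2 ≤ z ^ a := by
      rw [← Real.rpow_natCast]
      rcases hz0.eq_or_lt with h0 | h0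
      · rw [← h0]
        rw [Real.zero_rpow (by norm_num)]
        exact Real.rpow_nonneg le_rfl _
      · exact Real.rpow_le_rpow_of_exponent_ge h0 h (by simpa using ha2)
    refine (hη.norm_one_sub_fourier_le_sq ξ).trans ?_
    have : 0 ≤ z ^ a := by positivity
    nlinarith [sq_nonneg r, mul_le_mul_of_nonneg_left h1 (sq_nonneg r)]

/-! ### Folding integrals over a lattice -/

/-- The cube with side length `L` centred at `L * m`. -/
def cell {d : ℕ} (L : ℝ) (m : Fin d → ℤ) : Set (E d) :=
  {ξ | ∀ i, ξ i ∈ Ioc (L * (m i - 1 / 2)) (L * (m i + 1 / 2))}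

/-- The lattice point `L * m`. -/
def latticePoint {d : ℕ} (L : ℝ) (m : Fin d → ℤ) : E d :=
  WithLp.toLp 2 fun i => L * m i

theorem latticePoint_zero {d : ℕ} (L : ℝ) : latticePoint L (0 : Fin d → ℤ) = 0 := by
  ext i; simp [latticePoint]

theorem measurableSet_cell {d : ℕ} (L : ℝ) (m : Fin d → ℤ) : MeasurableSet (cell L m) := by
  have : cell L m = ⋂ i, (fun ξ : E d => ξ i) ⁻¹' Ioc (L * (m i - 1 / 2)) (L * (m i + 1 / 2)) := by
    ext ξ; simp [cell]
  rw [this]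
  exact MeasurableSet.iInter fun i =>
    (by fun_prop : Continuous fun ξ : E d => ξ i).measurable measurableSet_Ioc

/-- With half-open cells the index is a ceiling, so covering and disjointness are its existence and
uniqueness. -/
theorem mem_cell_iff {d : ℕ} {L : ℝ} (hL : 0 < L) (m : Fin d → ℤ) (ξ : E d) :
    ξ ∈ cell L m ↔ ∀ i, m i = ⌈ξ i / L - 1 / 2⌉ := by
  refine forall_congr' fun i => ?_
  rw [eq_comm, Int.ceil_eq_iff, mem_Ioc, ← lt_div_iff₀' hL, ← div_le_iff₀' hL]
  constructor <;> rintro ⟨a, b⟩ <;> constructor <;> linarith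

theorem iUnion_cell (d : ℕ) {L : ℝ} (hL : 0 < L) : ⋃ m : Fin d → ℤ, cell L m = univ :=
  eq_univ_of_forall fun ξ => mem_iUnion.2
    ⟨fun i => ⌈ξ i / L - 1 / 2⌉, (mem_cell_iff hL _ _).2 fun _ => rfl⟩

theorem pairwise_disjoint_cell (d : ℕ) {L : ℝ} (hL : 0 < L) :
    Pairwise (Function.onFun Disjoint (cell (d := d) L)) := by
  intro m n hmn
  refine Set.disjoint_left.2 fun ξ h1 h2 => hmn (funext fun i => ?_)
  rw [(mem_cell_iff hL _ _).1 h1 i, (mem_cell_iff hL _ _).1 h2 i]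

theorem add_latticePoint_mem_cell {d : ℕ} (L : ℝ) (m : Fin d → ℤ) (ξ : E d) :
    ξ + latticePoint L m ∈ cell L m ↔ ξ ∈ cell L 0 := by
  refine forall_congr' fun i => ?_
  simp only [latticePoint, PiLp.add_apply, mem_Ioc, Pi.zero_apply, Int.cast_zero]
  constructor <;> rintro ⟨a, b⟩ <;> constructor <;> linarith

theorem setLIntegral_cell {d : ℕ} (L : ℝ) (F : E d → ℝ≥0∞) (m : Fin d → ℤ) :
    ∫⁻ ξ in cell L m, F ξ = ∫⁻ ξ in cell L 0, F (ξ + latticePoint L m) := by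
  rw [← (measurePreserving_add_right volume (latticePoint L m)).setLIntegral_comp_preimage_emb
    (measurableEmbedding_addRight _)]
  congr 2
  ext ξ
  exact add_latticePoint_mem_cell L m ξ

theorem setIntegral_cell {d : ℕ} (L : ℝ) (F : E d → ℂ) (m : Fin d → ℤ) :
    ∫ ξ in cell L m, F ξ = ∫ ξ in cell L 0, F (ξ + latticePoint L m) := by
  rw [← (measurePreserving_add_right volume (latticePoint L m)).setIntegral_preimage_emb
    (measurableEmbedding_addRight _)]
  congr 2
  ext ξ
  exact add_latticePoint_mem_cell L m ξ

theorem lintegral_eq_lintegral_cell {d : ℕ} {L : ℝ} (hL : 0 < L) {F : E d → ℝ≥0∞}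
    (hF : AEMeasurable F) :
    ∫⁻ ξ, F ξ = ∫⁻ ξ in cell L 0, ∑' m : Fin d → ℤ, F (ξ + latticePoint L m) := by
  have hm : ∀ m : Fin d → ℤ, AEMeasurable (fun ξ => F (ξ + latticePoint L m))
      (volume.restrict (cell L 0)) := fun m => (hF.comp_quasiMeasurePreserving
      (measurePreserving_add_right volume (latticePoint L m)).quasiMeasurePreserving).restrict
  rw [lintegral_tsum hm]
  simp_rw [← setLIntegral_cell]
  rw [← setLIntegral_univ, ← iUnion_cell d hL]
  exact lintegral_iUnion (measurableSet_cell L) (pairwise_disjoint_cell d hL) F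

/-- The periodization of `h` with respect to the lattice `L * ℤ^d`. -/
noncomputable def periodize {d : ℕ} (L : ℝ) (h : E d → ℂ) (ξ : E d) : ℂ :=
  ∑' m : Fin d → ℤ, h (ξ + latticePoint L m)

theorem ae_summable_norm_of_integrable {d : ℕ} {L : ℝ} (hL : 0 < L) {h : E d → ℂ}
    (hh : Integrable h) : ∀ᵐ ξ ∂(volume.restrict (cell L 0)),
      Summable fun m : Fin d → ℤ => ‖h (ξ + latticePoint L m)‖ := by
  have h1 := hh.hasFiniteIntegral
  rw [hasFiniteIntegral_iff_enorm, lintegral_eq_lintegral_cell hL hh.1.enorm] at h1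
  have h2 := ae_lt_top' ?_ h1.ne
  · filter_upwards [h2] with ξ hξ
    exact summable_norm_iff.2 (Summable.of_enorm hξ.ne)
  · exact AEMeasurable.tsum fun m => (hh.1.enorm.comp_quasiMeasurePreserving
      (measurePreserving_add_right volume (latticePoint L m)).quasiMeasurePreserving).restrict

theorem setIntegral_periodize {d : ℕ} {L : ℝ} (hL : 0 < L) {h : E d → ℂ}
    (hh : Integrable h) : ∫ ξ in cell L 0, periodize L h ξ = ∫ ξ, h ξ := by
  unfold periodize
  have hm : ∀ m : Fin d → ℤ, AEStronglyMeasurable (fun ξ => h (ξ + latticePoint L m))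
      (volume.restrict (cell L 0)) := fun m => (hh.1.comp_quasiMeasurePreserving
      (measurePreserving_add_right volume (latticePoint L m)).quasiMeasurePreserving).restrict
  rw [integral_tsum hm]
  · simp_rw [← setIntegral_cell]
    rw [← setIntegral_univ, ← iUnion_cell d hL]
    exact (integral_iUnion (measurableSet_cell L) (pairwise_disjoint_cell d hL)
      hh.integrableOn).symm
  · rw [← lintegral_tsum fun m => (hm m).enorm, ← lintegral_eq_lintegral_cell hL hh.1.enorm]
    exact hh.hasFiniteIntegral.ne

theorem aestronglyMeasurable_periodize {d : ℕ} {L : ℝ} {h : E d → ℂ}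
    (hh : AEStronglyMeasurable h) : AEStronglyMeasurable (periodize L h) := by
  have hm : ∀ m : Fin d → ℤ, AEStronglyMeasurable (fun ξ => h (ξ + latticePoint L m)) :=
    fun m => hh.comp_quasiMeasurePreserving
      (measurePreserving_add_right volume (latticePoint L m)).quasiMeasurePreserving
  exact (AEMeasurable.tsum fun m => (hm m).aemeasurable).aestronglyMeasurable

/-! ### Parseval's identity on a cube -/

section Torus

noncomputable local instance : MeasureSpace UnitAddCircle := ⟨AddCircle.haarAddCircle⟩

local instance : Measure.IsAddHaarMeasure (volume : Measure UnitAddCircle) :=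
  inferInstanceAs (Measure.IsAddHaarMeasure AddCircle.haarAddCircle)

local instance : IsProbabilityMeasure (volume : Measure UnitAddCircle) :=
  inferInstanceAs (IsProbabilityMeasure AddCircle.haarAddCircle)

/-- The representative in the unit cube centred at the origin of a point of the torus. -/
noncomputable def torusRepr {d : ℕ} (y : UnitAddTorus (Fin d)) : E d :=
  WithLp.toLp 2 (UnitAddTorus.measurableEquivPiIoc (fun _ => -(1 / 2)) y).1

theorem measurableSet_pi_Ioc (d : ℕ) : MeasurableSet
    {x : Fin d → ℝ | ∀ i, x i ∈ Ioc (-(1 / 2) : ℝ) (-(1 / 2) + 1)} :=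
  MeasurableSet.univ_pi' fun _ => measurableSet_Ioc

theorem measurableEmbedding_torusRepr (d : ℕ) :
    MeasurableEmbedding (torusRepr : UnitAddTorus (Fin d) → E d) :=
  (MeasurableEquiv.toLp 2 (Fin d → ℝ)).measurableEmbedding.comp
    ((MeasurableEmbedding.subtype_coe (measurableSet_pi_Ioc d)).comp
      (UnitAddTorus.measurableEquivPiIoc (fun _ => -(1 / 2))).measurableEmbedding)

theorem toLp_preimage_cell (d : ℕ) :
    WithLp.toLp 2 ⁻¹' (cell 1 0 : Set (E d)) =
      {x : Fin d → ℝ | ∀ i, x i ∈ Ioc (-(1 / 2) : ℝ) (-(1 / 2) + 1)} := by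
  ext x
  simp only [cell, mem_preimage, mem_ofPred_eq]
  norm_num

theorem measurePreserving_torusRepr (d : ℕ) :
    MeasurePreserving (torusRepr : UnitAddTorus (Fin d) → E d) volume
      (volume.restrict (cell 1 0)) := by
  have h1 := UnitAddTorus.measurePreserving_equivPiIoc (fun _ : Fin d => (-(1 / 2) : ℝ))
  have h2 := measurePreserving_subtype_coe (μa := (volume : Measure (Fin d → ℝ)))
    (measurableSet_pi_Ioc d)
  have h3 := (PiLp.volume_preserving_toLp (Fin d)).restrict_preimage
    (measurableSet_cell (d := d) 1 0)
  rw [toLp_preimage_cell] at h3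
  exact h3.comp (h2.comp h1)

theorem mFourier_eq_exp {d : ℕ} (k : Fin d → ℤ) (y : UnitAddTorus (Fin d)) :
    UnitAddTorus.mFourier k y = Complex.exp
      (((2 * Real.pi * inner ℝ (torusRepr y) (latticePoint 1 k) : ℝ) : ℂ) * Complex.I) := by
  have hy : ∀ i, y i = ((torusRepr y i : ℝ) : UnitAddCircle) := fun i =>
    (congrFun ((UnitAddTorus.measurableEquivPiIoc (fun _ => -(1 / 2))).symm_apply_apply y) i).symm
  rw [inner_eq_sum, Finset.mul_sum]
  push_cast
  rw [Finset.sum_mul, Complex.exp_sum]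
  change ∏ i, fourier (k i) (y i) = _
  refine Finset.prod_congr rfl fun i _ => ?_
  rw [hy i, fourier_coe_apply]
  congr 1
  simp [latticePoint]
  ring

theorem mFourierCoeff_comp_torusRepr {d : ℕ} (F : E d → ℂ)
    (f : Lp ℂ 2 (volume : Measure (UnitAddTorus (Fin d))))
    (hf : f =ᵐ[volume] fun y => F (torusRepr y)) (k : Fin d → ℤ) :
    UnitAddTorus.mFourierCoeff f (-k) = ∫ ζ in cell 1 0, Complex.exp
      (((2 * Real.pi * inner ℝ ζ (latticePoint 1 k) : ℝ) : ℂ) * Complex.I) * F ζ := by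
  rw [← (measurePreserving_torusRepr d).integral_comp (measurableEmbedding_torusRepr d)]
  refine integral_congr_ae ?_
  filter_upwards [hf] with y hy
  rw [hy, neg_neg, mFourier_eq_exp, smul_eq_mul]

open scoped ComplexConjugate in
-- Parseval on the torus for `F` and `ζ ↦ exp(-2πi x·ζ)`: the Fourier coefficients of the latter,
-- restricted to the cell, are the shifted sinc products.
theorem hasSum_sinc_unitCell {d : ℕ} {F : E d → ℂ} (hF : MemLp F 2 (volume.restrict (cell 1 0)))
    (x : E d) :
    HasSum (fun k : Fin d → ℤ => (∫ ζ in cell 1 0, Complex.exp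
        (((2 * Real.pi * inner ℝ ζ (latticePoint 1 k) : ℝ) : ℂ) * Complex.I) * F ζ) *
          ((∏ i, Real.sinc (Real.pi * (x i - k i)) : ℝ) : ℂ))
      (∫ ζ in cell 1 0,
        Complex.exp (((2 * Real.pi * inner ℝ ζ x : ℝ) : ℂ) * Complex.I) * F ζ) := by
  let e : E d → E d → ℂ := fun y ζ =>
    Complex.exp (((2 * Real.pi * inner ℝ ζ y : ℝ) : ℂ) * Complex.I)
  have hconj : ∀ y ζ, conj (e y ζ) = e (-y) ζ := by
    intro y ζ
    simp only [e, ← Complex.exp_conj, map_mul, Complex.conj_ofReal, Complex.conj_I,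
      inner_neg_right]
    congr 1; push_cast; ring
  have hmul : ∀ y z ζ, e y ζ * e z ζ = e (y + z) ζ := by
    intro y z ζ
    simp only [e, ← Complex.exp_add, inner_add_right]
    congr 1; push_cast; ring
  have hFt : MemLp (fun y => F (torusRepr y)) 2 (volume : Measure (UnitAddTorus (Fin d))) :=
    hF.comp_measurePreserving (measurePreserving_torusRepr d)
  have het : MemLp (fun y => e (-x) (torusRepr y)) 2
      (volume : Measure (UnitAddTorus (Fin d))) := by
    refine MemLp.of_bound ?_ 1 (Filter.Eventually.of_forall fun y => ?_)
    · refine Measurable.aestronglyMeasurable (Measurable.comp (g := e (-x)) ?_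
        (measurableEmbedding_torusRepr d).measurable)
      exact Continuous.measurable (by fun_prop)
    · exact (Complex.norm_exp_ofReal_mul_I _).le
  have key := UnitAddTorus.hasSum_prod_mFourierCoeff (het.toLp _) (hFt.toLp _)
  -- Fourier coefficients carry `exp(-2πi k·ζ)`, samples carry `exp(+2πi k·ζ)`; hence the reindexing
  -- by `k ↦ -k`.
  rw [← (Equiv.neg (Fin d → ℤ)).hasSum_iff] at key
  convert! key using 1
  · ext k
    simp only [Function.comp, Equiv.neg_apply]
    rw [mFourierCoeff_comp_torusRepr F _ hFt.coeFn_toLp,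
      mFourierCoeff_comp_torusRepr (e (-x)) _ het.coeFn_toLp, mul_comm, ← integral_conj]
    congr 1
    have h : ∀ ζ : E d, conj (e (latticePoint 1 k) ζ * e (-x) ζ) = e (x - latticePoint 1 k) ζ := by
      intro ζ
      rw [hmul, hconj]
      congr 1; abel
    change _ = ∫ ζ in cell 1 0, conj (e (latticePoint 1 k) ζ * e (-x) ζ)
    simp_rw [h]
    have hc : (cell 1 0 : Set (E d)) = {x | ∀ i, x i ∈ Ioc (-(1 / 2) : ℝ) (1 / 2)} := by
      simp [cell]
    rw [hc, setIntegral_unitCube_exp]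
    simp [latticePoint]
  · rw [← (measurePreserving_torusRepr d).integral_comp (measurableEmbedding_torusRepr d)]
    refine integral_congr_ae ?_
    filter_upwards [hFt.coeFn_toLp, het.coeFn_toLp] with y h1 h2
    rw [h1, h2, hconj, neg_neg]

end Torus

/-! ### Rescaling from the unit cell to side length `L`. -/

theorem smul_cell {d : ℕ} {L : ℝ} (hL : 0 < L) : L • (cell 1 0 : Set (E d)) = cell L 0 := by
  ext ξ
  rw [Set.mem_smul_set_iff_inv_smul_mem₀ hL.ne', mem_cell_iff one_pos, mem_cell_iff hL]
  refine forall_congr' fun i => ?_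
  rw [PiLp.smul_apply, smul_eq_mul, div_one, inv_mul_eq_div]

theorem memLp_comp_smul_unitCell {d : ℕ} {L : ℝ} (hL : 0 < L) {F : E d → ℂ}
    (hF : MemLp F 2 (volume.restrict (cell L 0))) :
    MemLp (fun ζ => F (L • ζ)) 2 (volume.restrict (cell 1 0)) := by
  have hemb : MeasurableEmbedding (fun ζ : E d => L • ζ) :=
    (Homeomorph.smulOfNeZero L hL.ne').measurableEmbedding
  have hmap : (volume.restrict (cell 1 0)).map (fun ζ : E d => L • ζ) =
      ENNReal.ofReal |(L ^ Module.finrank ℝ (E d))⁻¹| • volume.restrict (cell L 0) := by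
    have h := Measure.map_addHaar_smul (volume : Measure (E d)) hL.ne'
    rw [← Measure.restrict_smul, ← h, hemb.restrict_map]
    congr 2
    rw [← smul_cell hL]
    ext ζ
    simp [Set.smul_mem_smul_set_iff₀ hL.ne']
  refine (hemb.memLp_map_measure_iff (g := F)).1 ?_
  rw [hmap]
  exact hF.smul_measure ENNReal.ofReal_ne_top

theorem setIntegral_cell_comp_smul {d : ℕ} {L : ℝ} (hL : 0 < L) (F : E d → ℂ) :
    ∫ ξ in cell L 0, F ξ = ((L ^ d : ℝ) : ℂ) * ∫ ζ in cell 1 0, F (L • ζ) := by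
  rw [Measure.setIntegral_comp_smul_of_pos volume F (cell 1 0) hL, smul_cell hL,
    finrank_euclideanSpace_fin, ← Complex.real_smul, smul_smul, mul_inv_cancel₀ (by positivity),
    one_smul]

theorem hasSum_sincBasis_cell {d : ℕ} {N : ℕ} (hN : 0 < N) {F : E d → ℂ}
    (hF : MemLp F 2 (volume.restrict (cell N 0))) (x : E d) :
    HasSum (fun k : Fin d → ℤ => (∫ ξ in cell N 0, Complex.exp
        (((2 * Real.pi * inner ℝ ξ (gridPoint N k) : ℝ) : ℂ) * Complex.I) * F ξ) *
          (sincBasis N k x : ℂ))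
      (∫ ξ in cell N 0,
        Complex.exp (((2 * Real.pi * inner ℝ ξ x : ℝ) : ℂ) * Complex.I) * F ξ) := by
  have hL : (0 : ℝ) < N := Nat.cast_pos.2 hN
  have h := (hasSum_sinc_unitCell (memLp_comp_smul_unitCell hL hF) ((N : ℝ) • x)).mul_left
    (((N : ℝ) ^ d : ℝ) : ℂ)
  convert! h using 1
  · ext k
    rw [setIntegral_cell_comp_smul hL, mul_assoc]
    congr 2
    · refine integral_congr_ae (Filter.Eventually.of_forall fun ζ => ?_)
      have : inner ℝ ((N : ℝ) • ζ) (gridPoint N k) = inner ℝ ζ (latticePoint 1 k) := by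
        rw [inner_eq_sum, inner_eq_sum]
        refine Finset.sum_congr rfl fun i _ => ?_
        simp only [PiLp.smul_apply, smul_eq_mul, gridPoint, latticePoint]
        field_simp
      simp only [this]
  · rw [setIntegral_cell_comp_smul hL]
    congr 1
    refine integral_congr_ae (Filter.Eventually.of_forall fun ζ => ?_)
    simp only [inner_smul_left, inner_smul_right]
    simp

/-! ### The sinc interpolant of an inverse Fourier transform -/

/-- This is aliasing: `N m` and `k / N` have an integer inner product. -/
theorem exp_inner_gridPoint_add {d : ℕ} {N : ℕ} (hN : 0 < N) (k m : Fin d → ℤ) (ξ : E d) :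
    Complex.exp (((2 * Real.pi * inner ℝ (ξ + latticePoint N m) (gridPoint N k) : ℝ) : ℂ) *
      Complex.I) =
    Complex.exp (((2 * Real.pi * inner ℝ ξ (gridPoint N k) : ℝ) : ℂ) * Complex.I) := by
  have hL : (N : ℝ) ≠ 0 := by positivity
  have : inner ℝ (latticePoint N m) (gridPoint N k) = ((∑ i, m i * k i : ℤ) : ℝ) := by
    rw [inner_eq_sum]
    push_cast
    refine Finset.sum_congr rfl fun i _ => ?_
    simp only [gridPoint, latticePoint]
    field_simp
  rw [inner_add_left, this, Complex.exp_eq_exp_iff_exists_int]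
  exact ⟨∑ i, m i * k i, by push_cast; ring⟩

theorem fourierInv_gridPoint {d : ℕ} {N : ℕ} (hN : 0 < N) {h : E d → ℂ} (hh : Integrable h)
    (k : Fin d → ℤ) : 𝓕⁻ h (gridPoint N k) = ∫ ξ in cell N 0, Complex.exp
      (((2 * Real.pi * inner ℝ ξ (gridPoint N k) : ℝ) : ℂ) * Complex.I) * periodize N h ξ := by
  have hL : (0 : ℝ) < N := Nat.cast_pos.2 hN
  rw [Real.fourierInv_eq', ← setIntegral_periodize hL]
  · refine integral_congr_ae (Filter.Eventually.of_forall fun ξ => ?_)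
    -- In a field, constants leave a `tsum` without any summability, so the identity holds at every
    -- `ξ`.
    simp only [periodize, exp_inner_gridPoint_add hN, smul_eq_mul, tsum_mul_left]
  · refine hh.bdd_mul (c := 1) ?_ (Filter.Eventually.of_forall fun ξ => ?_)
    · exact Continuous.aestronglyMeasurable (by fun_prop)
    · exact (Complex.norm_exp_ofReal_mul_I _).le

theorem hasSum_sincInterp_fourierInv {d : ℕ} {N : ℕ} (hN : 0 < N) {h : E d → ℂ}
    (hh : Integrable h) (hP : MemLp (periodize N h) 2 (volume.restrict (cell N 0))) (x : E d) :
    HasSum (fun k : Fin d → ℤ => 𝓕⁻ h (gridPoint N k) * (sincBasis N k x : ℂ))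
      (𝓕⁻ (indicator (cell N 0) (periodize N h)) x) := by
  simp_rw [fourierInv_gridPoint hN hh]
  convert! hasSum_sincBasis_cell hN hP x using 1
  rw [Real.fourierInv_eq', ← integral_indicator (measurableSet_cell _ _)]
  refine integral_congr_ae (Filter.Eventually.of_forall fun ξ => ?_)
  simp only [smul_eq_mul, indicator_mul_right]

/-! ### Fourier transforms of square integrable functions -/

/-- On `L¹ ∩ L²` the integral and the Plancherel transform agree: tested against smooth compactly
supported functions, both move onto the test function. -/
theorem fourierInv_toLp_ae_eq {d : ℕ} {g : E d → ℂ} (h1 : Integrable g) (h2 : MemLp g 2) :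
    (𝓕⁻ (h2.toLp g) : Lp ℂ 2 (volume : Measure (E d))) =ᵐ[volume] 𝓕⁻ g := by
  have hcont : Continuous (𝓕⁻ g) := by
    rw [Real.fourierInv_eq_fourier_comp_neg]
    exact VectorFourier.fourierIntegral_continuous Real.continuous_fourierChar
      (by exact continuous_inner) h1.comp_neg
  refine ae_eq_of_integral_contDiff_smul_eq ((Lp.memLp _).locallyIntegrable one_le_two)
    hcont.locallyIntegrable fun φ hφ hc => ?_
  have hc' : HasCompactSupport (fun x => (φ x : ℂ)) :=
    hc.comp_left (g := fun r : ℝ => (r : ℂ)) Complex.ofReal_zero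
  have hd' : ContDiff ℝ ∞ (fun x => (φ x : ℂ)) := Complex.ofRealCLM.contDiff.comp hφ
  let Φ : 𝓢(E d, ℂ) := hc'.toSchwartzMap hd'
  have e1 : ∫ x, φ x • (𝓕⁻ (h2.toLp g) : Lp ℂ 2 (volume : Measure (E d))) x =
      ((𝓕⁻ (h2.toLp g) : Lp ℂ 2 (volume : Measure (E d))) : 𝓢'(E d, ℂ)) Φ := by
    rw [Lp.toTemperedDistribution_apply]
    rfl
  rw [e1, ← Lp.fourierInv_toTemperedDistribution_eq, TemperedDistribution.fourierInv_apply,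
    Lp.toTemperedDistribution_apply]
  have e2 : ∫ x, φ x • 𝓕⁻ g x = ∫ x, 𝓕⁻ g x * Φ x := by
    refine integral_congr_ae (Filter.Eventually.of_forall fun x => ?_)
    simp only [Complex.real_smul, mul_comm]
    rfl
  have e3 : ∫ x, (𝓕⁻ Φ) x • (h2.toLp g) x = ∫ x, g x * 𝓕⁻ (Φ : E d → ℂ) x := by
    refine integral_congr_ae ?_
    filter_upwards [h2.coeFn_toLp] with x hx
    rw [hx, smul_eq_mul, mul_comm, SchwartzMap.fourierInv_coe]
  rw [e2, e3]
  have key := VectorFourier.integral_fourierIntegral_smul_eq_flip (L := -innerₗ (E d))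
    (μ := volume) (ν := volume) Real.continuous_fourierChar
    (by simpa using! continuous_inner.neg) h1 Φ.integrable
  simp only [smul_eq_mul] at key
  have f1 : ∀ x, 𝓕⁻ g x = VectorFourier.fourierIntegral Real.fourierChar volume
      (-innerₗ (E d)) g x := fun x => rfl
  have f2 : ∀ x, 𝓕⁻ (Φ : E d → ℂ) x = VectorFourier.fourierIntegral Real.fourierChar volume
      (-innerₗ (E d)).flip (Φ : E d → ℂ) x := by
    intro x
    rw [Real.fourierInv_eq]
    refine integral_congr_ae (Filter.Eventually.of_forall fun y => ?_)
    simp [real_inner_comm]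
  simp_rw [f1, f2]
  exact key.symm

theorem memLp_fourierInv {d : ℕ} {g : E d → ℂ} (h1 : Integrable g) (h2 : MemLp g 2) :
    MemLp (𝓕⁻ g) 2 :=
  (memLp_congr_ae (fourierInv_toLp_ae_eq h1 h2)).1 (Lp.memLp _)

theorem fourier_toLp_fourierInv {d : ℕ} {g : E d → ℂ} (h1 : Integrable g) (h2 : MemLp g 2)
    (hv : MemLp (𝓕⁻ g) 2) : 𝓕 (hv.toLp (𝓕⁻ g)) = h2.toLp g := by
  have : hv.toLp (𝓕⁻ g) = 𝓕⁻ (h2.toLp g) :=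
    Lp.ext (hv.coeFn_toLp.trans (fourierInv_toLp_ae_eq h1 h2).symm)
  rw [this, FourierTransform.fourier_fourierInv_eq]

/-! ### Bounding the Sobolev norm through the symbol. -/

theorem sobolevWeight_smul_apply {d : ℕ} (σ : ℝ) (φ : 𝓢(E d, ℂ)) (ξ : E d) :
    SchwartzMap.smulLeftCLM ℂ (sobolevWeight σ) φ ξ = sobolevWeight σ ξ * φ ξ := by
  rw [SchwartzMap.smulLeftCLM_apply_apply (sobolevWeight_hasTemperateGrowth _), smul_eq_mul]

theorem sobolevNorm_le {d : ℕ} (σ : ℝ) {T : 𝓢'(E d, ℂ)} {g : E d → ℂ}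
    (hT : ∀ φ : 𝓢(E d, ℂ), (𝓕 T) φ = ∫ ξ, φ ξ * g ξ)
    (hg : AEStronglyMeasurable g) :
    sobolevNorm σ T ≤ eLpNorm (fun ξ => sobolevWeight σ ξ * g ξ) 2 volume := by
  by_cases htop : eLpNorm (fun ξ => sobolevWeight σ ξ * g ξ) 2 volume = (⊤ : ℝ≥0∞)
  · rw [htop]; exact le_top
  have hw : AEStronglyMeasurable (sobolevWeight (d := d) σ) :=
    (sobolevWeight_hasTemperateGrowth σ).1.continuous.aestronglyMeasurable
  have hL : MemLp (fun ξ => sobolevWeight σ ξ * g ξ) 2 volume := ⟨hw.mul hg, lt_top_iff_ne_top.2 htop⟩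
  refine (iInf₂_le (hL.toLp _) ?_).trans (Lp.enorm_toLp hL).le
  ext φ
  rw [TemperedDistribution.smulLeftCLM_apply_apply, hT, Lp.toTemperedDistribution_apply]
  refine integral_congr_ae ?_
  filter_upwards [hL.coeFn_toLp] with ξ hξ
  rw [hξ, sobolevWeight_smul_apply, smul_eq_mul]
  ring

/-! ### The mollified fractional Laplacian -/

/-- The substitution `y = x - z` turns the inverse transform into a phase times the forward
transform; the dilation moves `ε` to the frequency. -/
theorem fourierInv_mollifierAt {d : ℕ} {r : ℝ} {ψ : E d → ℝ} (hψ : IsMollifier r ψ) {ε : ℝ}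
    (hε : 0 < ε) (x ξ : E d) :
    (𝓕⁻ (mollifierAt hψ hε x)) ξ =
      Complex.exp (((2 * Real.pi * inner ℝ ξ x : ℝ) : ℂ) * Complex.I) *
        𝓕 (fun y => (sincMollifier ψ y : ℂ)) (ε • ξ) := by
  rw [SchwartzMap.fourierInv_coe, Real.fourierInv_eq', Real.fourier_eq',
    ← integral_sub_left_eq_self _ volume x]
  have h := Measure.integral_comp_inv_smul_of_nonneg (volume : Measure (E d))
    (fun z : E d => Complex.exp (((-2 * Real.pi * inner ℝ z (ε • ξ) : ℝ) : ℂ) * Complex.I) •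
      (sincMollifier ψ z : ℂ)) hε.le
  rw [finrank_euclideanSpace_fin] at h
  have h' : ∫ z : E d, Complex.exp (((-2 * Real.pi * inner ℝ z (ε • ξ) : ℝ) : ℂ) * Complex.I) •
      (sincMollifier ψ z : ℂ) = (((ε ^ d)⁻¹ : ℝ) : ℂ) * ∫ z : E d,
        Complex.exp (((-2 * Real.pi * inner ℝ (ε⁻¹ • z) (ε • ξ) : ℝ) : ℂ) * Complex.I) •
      (sincMollifier ψ (ε⁻¹ • z) : ℂ) := by
    rw [h, ← Complex.real_smul, smul_smul, inv_mul_cancel₀ (by positivity), one_smul]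
  rw [h', ← integral_const_mul, ← integral_const_mul]
  refine integral_congr_ae (Filter.Eventually.of_forall fun z => ?_)
  have e1 : mollifierAt hψ hε x (x - z) = (((ε ^ d)⁻¹ : ℝ) : ℂ) * (sincMollifier ψ (ε⁻¹ • z) : ℂ) := by
    change scaled _ ε (x - (x - z)) = _
    rw [sub_sub_cancel, scaled, Complex.ofReal_mul]
  have e2 : inner ℝ (ε⁻¹ • z) (ε • ξ) = inner ℝ z ξ := by
    rw [inner_smul_left, inner_smul_right]
    simp [hε.ne']
  simp only [e1, e2, inner_sub_left, smul_eq_mul]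
  rw [real_inner_comm ξ x, mul_sub, Complex.ofReal_sub, sub_mul, Complex.exp_sub,
    show (((-2 * Real.pi * inner ℝ z ξ : ℝ) : ℂ) * Complex.I) =
      -(((2 * Real.pi * inner ℝ z ξ : ℝ) : ℂ) * Complex.I) by push_cast; ring, Complex.exp_neg]
  ring

/-- The Fourier transform `|ω|^(2s) * û` of `(-Δ)^s u`, at `ω = 2πξ`. -/
noncomputable def fracSymbol {d : ℕ} (s : ℝ) (u : Lp ℂ 2 (volume : Measure (E d))) (ξ : E d) : ℂ :=
  ((‖(2 * Real.pi) • ξ‖ ^ (2 * s) : ℝ) : ℂ) * (𝓕 u) ξ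

/-- The Fourier transform of the mollified distribution `η_ε * (-Δ)^s u`, at `ω = 2πξ`. -/
noncomputable def mollifiedSymbol {d : ℕ} (ψ : E d → ℝ) (s ε : ℝ)
    (u : Lp ℂ 2 (volume : Measure (E d))) (ξ : E d) : ℂ :=
  𝓕 (fun y => (sincMollifier ψ y : ℂ)) (ε • ξ) * fracSymbol s u ξ

theorem mollify_eq_fourierInv {d : ℕ} {r : ℝ} {ψ : E d → ℝ} (hψ : IsMollifier r ψ) {ε : ℝ}
    (hε : 0 < ε) {s : ℝ} {u : Lp ℂ 2 (volume : Measure (E d))} {f : 𝓢'(E d, ℂ)}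
    (hf : IsFracLaplacian s u f) : mollify hψ hε f = 𝓕⁻ (mollifiedSymbol ψ s ε u) := by
  ext x
  have h : mollify hψ hε f x = (𝓕 f) (𝓕⁻ (mollifierAt hψ hε x)) := by
    rw [TemperedDistribution.fourier_apply, FourierTransform.fourier_fourierInv_eq, mollify]
  rw [h, hf, Real.fourierInv_eq']
  refine integral_congr_ae (Filter.Eventually.of_forall fun ξ => ?_)
  simp only [fourierInv_mollifierAt, mollifiedSymbol, fracSymbol, smul_eq_mul]
  ring

theorem aestronglyMeasurable_fracSymbol {d : ℕ} (s : ℝ) (u : Lp ℂ 2 (volume : Measure (E d))) :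
    AEStronglyMeasurable (fracSymbol s u) := by
  refine AEStronglyMeasurable.mul (Measurable.aestronglyMeasurable ?_)
    (Lp.aestronglyMeasurable _)
  fun_prop

theorem aestronglyMeasurable_mollifiedSymbol {d : ℕ} {ψ : E d → ℝ}
    (hψ : IsMollifier (Real.sqrt d / 4) ψ) (s ε : ℝ) (u : Lp ℂ 2 (volume : Measure (E d))) :
    AEStronglyMeasurable (mollifiedSymbol ψ s ε u) :=
  (hψ.sincMollifier.continuous_fourier.comp (continuous_const_smul ε)).aestronglyMeasurable.mul
    (aestronglyMeasurable_fracSymbol s u)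

theorem norm_sobolevWeight {d : ℕ} (σ : ℝ) (ξ : E d) :
    ‖sobolevWeight σ ξ‖ = (1 + ‖(2 * Real.pi) • ξ‖ ^ 2) ^ (σ / 2) :=
  Complex.norm_of_nonneg (by positivity)

theorem rpow_le_norm_sobolevWeight {d : ℕ} {s : ℝ} (hs : 0 ≤ s) (ξ : E d) :
    ‖(2 * Real.pi) • ξ‖ ^ s ≤ ‖sobolevWeight s ξ‖ := by
  rw [norm_sobolevWeight]
  calc ‖(2 * Real.pi) • ξ‖ ^ s = (‖(2 * Real.pi) • ξ‖ ^ 2) ^ (s / 2) := by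
        rw [← Real.rpow_natCast, ← Real.rpow_mul (norm_nonneg _)]
        congr 1; push_cast; ring
    _ ≤ _ := Real.rpow_le_rpow (by positivity) (by linarith) (by linarith)

theorem norm_sobolevWeight_neg_mul_rpow_le {d : ℕ} {s : ℝ} (hs : 0 ≤ s) (ξ : E d) :
    ‖sobolevWeight (-s) ξ‖ * ‖(2 * Real.pi) • ξ‖ ^ s ≤ 1 := by
  have h := rpow_le_norm_sobolevWeight hs ξ
  have e : ‖sobolevWeight (-s) ξ‖ * ‖sobolevWeight s ξ‖ = 1 := by
    rw [norm_sobolevWeight, norm_sobolevWeight, ← Real.rpow_add (by positivity)]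
    rw [show -s / 2 + s / 2 = 0 by ring, Real.rpow_zero]
  rw [← e]
  exact mul_le_mul_of_nonneg_left h (norm_nonneg _)

theorem norm_sobolevWeight_mul_fracSymbol_le {d : ℕ} {s : ℝ} (hs : 0 ≤ s)
    (u : Lp ℂ 2 (volume : Measure (E d))) (ξ : E d) :
    ‖sobolevWeight (-s) ξ‖ * ‖fracSymbol s u ξ‖ ≤ ‖(2 * Real.pi) • ξ‖ ^ s * ‖(𝓕 u) ξ‖ := by
  rw [fracSymbol, norm_mul, Complex.norm_of_nonneg (by positivity), ← mul_assoc]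
  refine mul_le_mul_of_nonneg_right ?_ (norm_nonneg _)
  rw [two_mul s, Real.rpow_add_of_nonneg (norm_nonneg _) hs hs, ← mul_assoc]
  exact mul_le_of_le_one_left (by positivity) (norm_sobolevWeight_neg_mul_rpow_le hs ξ)

/-- The growth `|ω|^(2s)` is charged to the Schwartz function through the weight `(1 + |ω|²)^s`,
leaving a product of two `L²` functions. -/
theorem integrable_schwartz_mul_fracSymbol {d : ℕ} {s : ℝ} (hs : 0 ≤ s)
    (u : Lp ℂ 2 (volume : Measure (E d))) (φ : 𝓢(E d, ℂ)) :
    Integrable fun ξ => φ ξ * fracSymbol s u ξ := by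
  have hΦ := SchwartzMap.memLp (SchwartzMap.smulLeftCLM ℂ (sobolevWeight (2 * s)) φ) 2
    (volume : Measure (E d))
  have h : Integrable fun ξ =>
      SchwartzMap.smulLeftCLM ℂ (sobolevWeight (2 * s)) φ ξ * (𝓕 u) ξ :=
    hΦ.integrable_mul (Lp.memLp (𝓕 u))
  refine h.mono (φ.continuous.aestronglyMeasurable.mul (aestronglyMeasurable_fracSymbol s u))
    (Filter.Eventually.of_forall fun ξ => ?_)
  simp only [fracSymbol, sobolevWeight_smul_apply, norm_mul]
  rw [Complex.norm_of_nonneg (by positivity), ← mul_assoc, mul_comm ‖φ ξ‖]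
  have := rpow_le_norm_sobolevWeight (by positivity : 0 ≤ 2 * s) ξ
  gcongr

/-! ### Decay and aliasing -/

theorem tsum_mul_sq_le {ι : Type*} [Countable ι] (a b : ι → ℝ≥0∞) :
    (∑' m, a m * b m) ^ 2 ≤ (∑' m, a m ^ 2) * ∑' m, b m ^ 2 := by
  let _ : MeasurableSpace ι := ⊤
  have h := ENNReal.lintegral_mul_le_Lp_mul_Lq (Measure.count : Measure ι)
    Real.HolderConjugate.two_two (f := a) (g := b) Measurable.of_discrete.aemeasurable
    Measurable.of_discrete.aemeasurable
  simp only [lintegral_count, Pi.mul_apply, ENNReal.rpow_two] at h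
  have h2 := pow_le_pow_left₀ bot_le h 2
  rw [mul_pow, ← ENNReal.rpow_mul_natCast, ← ENNReal.rpow_mul_natCast] at h2
  simpa using h2

theorem abs_le_of_mem_cell {d : ℕ} {ζ : E d} (hζ : ζ ∈ cell 1 0) (i : Fin d) :
    |ζ i| ≤ 1 / 2 := by
  have := hζ i
  simp only [Pi.zero_apply, Int.cast_zero, mem_Ioc] at this
  exact abs_le.2 ⟨by linarith, by linarith⟩

theorem volume_cell_ne_top {d : ℕ} {L : ℝ} (hL : 0 < L) :
    volume (cell L 0 : Set (E d)) ≠ ⊤ := by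
  refine ((measure_mono ?_).trans_lt
    (measure_closedBall_lt_top (x := (0 : E d)) (r := Real.sqrt d * (L / 2)))).ne
  intro ξ hξ
  rw [mem_closedBall_zero_iff]
  refine norm_le_of_mem_cube (by positivity) fun i => ?_
  have := hξ i
  simp only [Pi.zero_apply, Int.cast_zero, mem_Ioc] at this
  exact abs_le.2 ⟨by linarith, by linarith⟩

/-- If the cell were null, folding the constant `1` would make the whole space null. -/
theorem volume_unitCell_ne_zero (d : ℕ) : volume (cell 1 0 : Set (E d)) ≠ 0 := by
  intro h
  have := lintegral_eq_lintegral_cell (d := d) one_pos (F := fun _ => 1) aemeasurable_const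
  rw [Measure.restrict_eq_zero.2 h, lintegral_zero_measure, lintegral_one] at this
  exact NeZero.ne _ this

/-- The function `(1 + |ζ|)^(-d-1)`, which is square integrable on `ℝ^d`. -/
noncomputable def decay {d : ℕ} (ζ : E d) : ℝ := ((1 + ‖ζ‖) ^ (d + 1))⁻¹

theorem decay_nonneg {d : ℕ} (ζ : E d) : 0 ≤ decay ζ := by unfold decay; positivity

theorem decay_le_one {d : ℕ} (ζ : E d) : decay ζ ≤ 1 :=
  inv_le_one_of_one_le₀ (one_le_pow₀ (by linarith [norm_nonneg ζ]))

theorem decay_le_mul_decay {d : ℕ} {x y : E d} {c : ℝ} (h : ‖x - y‖ ≤ c) :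
    decay x ≤ (1 + c) ^ (d + 1) * decay y := by
  have hc : 0 ≤ c := (norm_nonneg _).trans h
  unfold decay
  rw [← div_eq_mul_inv, inv_le_comm₀ (by positivity) (by positivity), inv_div, ← div_pow]
  refine pow_le_pow_left₀ (by positivity) ?_ _
  rw [div_le_iff₀ (by positivity)]
  have : ‖y‖ ≤ ‖x‖ + c := by
    calc ‖y‖ = ‖x - (x - y)‖ := by rw [sub_sub_cancel]
      _ ≤ ‖x‖ + ‖x - y‖ := norm_sub_le _ _
      _ ≤ _ := by linarith
  nlinarith [norm_nonneg x]

theorem continuous_decay (d : ℕ) : Continuous (decay (d := d)) := by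
  unfold decay
  exact Continuous.inv₀ (by fun_prop) fun ζ => by positivity

theorem lintegral_decay_sq_ne_top (d : ℕ) :
    ∫⁻ ζ : E d, ENNReal.ofReal (decay ζ) ^ 2 ≠ ⊤ := by
  have h := finite_integral_one_add_norm (E := E d) (μ := volume) (r := 2 * d + 2)
    (by rw [finrank_euclideanSpace_fin]; have := d.cast_nonneg (α := ℝ); linarith)
  refine ne_of_lt (lt_of_le_of_lt (lintegral_mono fun ζ => ?_) h)
  rw [← ENNReal.ofReal_pow (decay_nonneg ζ)]
  refine ENNReal.ofReal_le_ofReal (le_of_eq ?_)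
  rw [decay, Real.rpow_neg (by positivity), inv_pow, ← pow_mul,
    show (2 * d + 2 : ℝ) = (((d + 1) * 2 : ℕ) : ℝ) by push_cast; ring, Real.rpow_natCast]

/-- `decay` changes by at most a fixed factor across a cell, so the lattice sum at one point is
bounded by its average over the cell, which unfolds to an integral over the whole space. -/
theorem exists_tsum_decay_sq_le (d : ℕ) : ∃ S : ℝ≥0∞, S ≠ ⊤ ∧ ∀ ζ ∈ (cell 1 0 : Set (E d)),
    ∑' m : Fin d → ℤ, ENNReal.ofReal (decay (ζ + latticePoint 1 m)) ^ 2 ≤ S := by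
  set K : ℝ≥0∞ := ENNReal.ofReal ((1 + Real.sqrt d * 1) ^ (d + 1)) ^ 2
  set I : ℝ≥0∞ := ∫⁻ ζ : E d, ENNReal.ofReal (decay ζ) ^ 2
  have hK : K ≠ ⊤ := ENNReal.pow_ne_top ENNReal.ofReal_ne_top
  have hmeas : Measurable fun ζ : E d => ENNReal.ofReal (decay ζ) ^ 2 :=
    ((continuous_decay d).measurable.ennreal_ofReal).pow_const 2
  refine ⟨K * I / volume (cell 1 0 : Set (E d)), ?_, fun ζ hζ => ?_⟩
  · exact (ENNReal.div_lt_top (ENNReal.mul_ne_top hK (lintegral_decay_sq_ne_top d))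
      (volume_unitCell_ne_zero d)).ne
  rw [ENNReal.le_div_iff_mul_le (Or.inl (volume_unitCell_ne_zero d))
    (Or.inl (volume_cell_ne_top one_pos)), ← setLIntegral_const]
  calc _ ≤ ∫⁻ ζ' in (cell 1 0 : Set (E d)), K * ∑' m : Fin d → ℤ,
        ENNReal.ofReal (decay (ζ' + latticePoint 1 m)) ^ 2 := by
        refine setLIntegral_mono' (measurableSet_cell 1 0) fun ζ' hζ' => ?_
        rw [← ENNReal.tsum_mul_left]
        refine ENNReal.tsum_le_tsum fun m => ?_
        rw [← mul_pow, ← ENNReal.ofReal_mul (by positivity)]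
        refine pow_le_pow_left₀ bot_le (ENNReal.ofReal_le_ofReal (decay_le_mul_decay ?_)) 2
        rw [add_sub_add_right_eq_sub]
        refine norm_le_of_mem_cube zero_le_one fun i => ?_
        have h1 := abs_le_of_mem_cell hζ i
        have h2 := abs_le_of_mem_cell hζ' i
        rw [PiLp.sub_apply]
        calc _ ≤ |ζ i| + |ζ' i| := abs_sub _ _
          _ ≤ 1 := by linarith
    _ = K * I := by
        rw [lintegral_const_mul' _ _ hK, ← lintegral_eq_lintegral_cell one_pos hmeas.aemeasurable]

theorem inv_smul_mem_unitCell {d : ℕ} {L : ℝ} (hL : 0 < L) {ξ : E d} (hξ : ξ ∈ cell L 0) :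
    L⁻¹ • ξ ∈ cell 1 0 := by
  rwa [← smul_cell hL, Set.mem_smul_set_iff_inv_smul_mem₀ hL.ne'] at hξ

theorem inv_smul_latticePoint {d : ℕ} {L : ℝ} (hL : 0 < L) (m : Fin d → ℤ) :
    L⁻¹ • (latticePoint L m : E d) = latticePoint 1 m := by
  ext i
  simp only [latticePoint, PiLp.smul_apply, smul_eq_mul]
  field_simp

/-- Cauchy–Schwarz in `m` separates `decay`, whose square sum is at most `S`, from `b²`, whose
lattice sum unfolds. -/
theorem setLIntegral_tsum_decay_sq_le {d : ℕ} {S : ℝ≥0∞} (hS : S ≠ ⊤)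
    (hS' : ∀ ζ ∈ (cell 1 0 : Set (E d)),
      ∑' m : Fin d → ℤ, ENNReal.ofReal (decay (ζ + latticePoint 1 m)) ^ 2 ≤ S)
    {L : ℝ} (hL : 0 < L) {b : E d → ℝ≥0∞} (hb : AEMeasurable b) :
    ∫⁻ ξ in cell L 0, (∑' m : Fin d → ℤ, ENNReal.ofReal (decay (L⁻¹ • (ξ + latticePoint L m))) *
      b (ξ + latticePoint L m)) ^ 2 ≤ S * ∫⁻ ξ, b ξ ^ 2 := by
  calc _ ≤ ∫⁻ ξ in cell L 0, S * ∑' m : Fin d → ℤ, b (ξ + latticePoint L m) ^ 2 := by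
        refine setLIntegral_mono' (measurableSet_cell L 0) fun ξ hξ => (tsum_mul_sq_le _ _).trans ?_
        gcongr
        simp_rw [smul_add, inv_smul_latticePoint hL]
        exact hS' _ (inv_smul_mem_unitCell hL hξ)
    _ = _ := by
        rw [lintegral_const_mul' _ _ hS, ← lintegral_eq_lintegral_cell hL (hb.pow_const 2)]

/-- After folding, `x ≤ 1 + x²` reduces the claim to the square bound, since the cell has finite
volume. -/
theorem integrable_of_enorm_le_decay {d : ℕ} {L : ℝ} (hL : 0 < L) {h : E d → ℂ}
    (hh : AEStronglyMeasurable h) {K : ℝ≥0∞} (hK : K ≠ ⊤) {v : E d → ℂ} (hv : MemLp v 2)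
    (hle : ∀ ξ, ‖h ξ‖ₑ ≤ K * (ENNReal.ofReal (decay (L⁻¹ • ξ)) * ‖v ξ‖ₑ)) :
    Integrable h := by
  obtain ⟨S, hS, hS'⟩ := exists_tsum_decay_sq_le d
  refine ⟨hh, hasFiniteIntegral_iff_enorm.2 ?_⟩
  have hb := setLIntegral_tsum_decay_sq_le hS hS' hL hv.1.enorm
  have hv2 : ∫⁻ ξ, ‖v ξ‖ₑ ^ 2 < ⊤ := by
    have := hv.2
    rw [eLpNorm_lt_top_iff_lintegral_rpow_enorm_lt_top two_ne_zero ENNReal.ofNat_ne_top] at this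
    simpa using this
  have hm : AEMeasurable fun ξ => ENNReal.ofReal (decay (L⁻¹ • ξ)) * ‖v ξ‖ₑ :=
    (((continuous_decay d).comp (continuous_const_smul L⁻¹)).measurable.ennreal_ofReal
      ).aemeasurable.mul hv.1.enorm
  calc ∫⁻ ξ, ‖h ξ‖ₑ ≤ ∫⁻ ξ, K * (ENNReal.ofReal (decay (L⁻¹ • ξ)) * ‖v ξ‖ₑ) := lintegral_mono hle
    _ = K * ∫⁻ ξ in cell L 0, ∑' m : Fin d → ℤ,
          ENNReal.ofReal (decay (L⁻¹ • (ξ + latticePoint L m))) * ‖v (ξ + latticePoint L m)‖ₑ := by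
        rw [lintegral_const_mul' _ _ hK, lintegral_eq_lintegral_cell hL hm]
    _ ≤ K * ∫⁻ ξ in cell L 0, (1 + (∑' m : Fin d → ℤ,
          ENNReal.ofReal (decay (L⁻¹ • (ξ + latticePoint L m))) *
            ‖v (ξ + latticePoint L m)‖ₑ) ^ 2) := by
        gcongr with ξ
        set x := ∑' m : Fin d → ℤ,
          ENNReal.ofReal (decay (L⁻¹ • (ξ + latticePoint L m))) * ‖v (ξ + latticePoint L m)‖ₑ
        rcases le_total x 1 with h1 | h1
        · exact h1.trans le_self_add
        · calc x = x * 1 := (mul_one _).symm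
            _ ≤ x * x := by gcongr
            _ = x ^ 2 := (sq x).symm
            _ ≤ _ := le_add_self
    _ < ⊤ := by
        rw [lintegral_add_left measurable_const, setLIntegral_const, one_mul]
        exact ENNReal.mul_lt_top hK.lt_top (ENNReal.add_lt_top.2
          ⟨(volume_cell_ne_top hL).lt_top, hb.trans_lt (ENNReal.mul_lt_top hS.lt_top hv2)⟩)

theorem setLIntegral_mul_periodize_sq_le {d : ℕ} {S : ℝ≥0∞} (hS : S ≠ ⊤)
    (hS' : ∀ ζ ∈ (cell 1 0 : Set (E d)),
      ∑' m : Fin d → ℤ, ENNReal.ofReal (decay (ζ + latticePoint 1 m)) ^ 2 ≤ S)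
    {L : ℝ} (hL : 0 < L) {h w : E d → ℂ} {K : ℝ≥0∞} (hK : K ≠ ⊤) {b : E d → ℝ≥0∞}
    (hb : AEMeasurable b)
    (hle : ∀ ξ ∈ cell L 0, ∀ m : Fin d → ℤ, ‖w ξ‖ₑ * ‖h (ξ + latticePoint L m)‖ₑ ≤
      K * (ENNReal.ofReal (decay (L⁻¹ • (ξ + latticePoint L m))) * b (ξ + latticePoint L m))) :
    ∫⁻ ξ in cell L 0, ‖w ξ * periodize L h ξ‖ₑ ^ 2 ≤ K ^ 2 * S * ∫⁻ ξ, b ξ ^ 2 := by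
  rw [mul_assoc]
  refine le_trans ?_ (mul_le_mul_right (setLIntegral_tsum_decay_sq_le hS hS' hL hb) (K ^ 2))
  rw [← lintegral_const_mul' _ _ (ENNReal.pow_ne_top hK)]
  refine setLIntegral_mono' (measurableSet_cell L 0) fun ξ hξ => ?_
  rw [← mul_pow, ← ENNReal.tsum_mul_left, enorm_mul]
  refine pow_le_pow_left₀ bot_le ?_ 2
  calc _ ≤ ‖w ξ‖ₑ * ∑' m : Fin d → ℤ, ‖h (ξ + latticePoint L m)‖ₑ := by
        gcongr; exact enorm_tsum_le_tsum_enorm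
    _ = ∑' m : Fin d → ℤ, ‖w ξ‖ₑ * ‖h (ξ + latticePoint L m)‖ₑ := ENNReal.tsum_mul_left.symm
    _ ≤ _ := ENNReal.tsum_le_tsum (hle ξ hξ)

/-- Only the translate `m = 0` of a point of the cell stays in the cell, so the cutoff removes
exactly one term and leaves the aliases. -/
theorem periodize_indicator_compl {d : ℕ} {L : ℝ} (hL : 0 < L) {h : E d → ℂ} {ξ : E d}
    (hξ : ξ ∈ cell L 0) (hs : Summable fun m : Fin d → ℤ => ‖h (ξ + latticePoint L m)‖) :
    periodize L (indicator (cell L 0)ᶜ h) ξ = periodize L h ξ - h ξ := by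
  have hin : ∀ m : Fin d → ℤ, indicator (cell L 0)ᶜ h (ξ + latticePoint L m) =
      h (ξ + latticePoint L m) - if m = 0 then h ξ else 0 := by
    intro m
    have hm := (add_latticePoint_mem_cell L m ξ).2 hξ
    by_cases h0 : m = 0
    · subst h0
      rw [indicator_of_notMem (by simpa using hm)]
      simp [latticePoint_zero]
    · rw [if_neg h0, sub_zero, indicator_of_mem]
      exact fun h' => Set.disjoint_left.1 (pairwise_disjoint_cell d hL h0) hm h'
  unfold periodize
  simp_rw [hin]
  rw [hs.of_norm.tsum_sub (hasSum_ite_eq (0 : Fin d → ℤ) (h ξ)).summable, tsum_ite_eq]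

/-! ### Bounds for the transform of the mollifier -/

theorem IsMollifier.exists_fourier_decay {d : ℕ} {r : ℝ} {ψ : E d → ℝ} (hψ : IsMollifier r ψ) :
    ∃ C : ℝ, 0 < C ∧ ∀ a : ℝ, 0 ≤ a → a ≤ 2 → ∀ ζ : E d,
      ‖𝓕 (fun x => (ψ x : ℂ)) ζ‖ * ‖ζ‖ ^ a ≤ C * decay ζ := by
  have hc' : HasCompactSupport (fun x => (ψ x : ℂ)) :=
    hψ.hasCompactSupport.comp_left (g := fun r : ℝ => (r : ℂ)) Complex.ofReal_zero
  have hd' : ContDiff ℝ ∞ (fun x => (ψ x : ℂ)) := Complex.ofRealCLM.contDiff.comp hψ.contDiff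
  let Φ : 𝓢(E d, ℂ) := hc'.toSchwartzMap hd'
  -- Of the `d + 3` powers, two absorb `‖ζ‖ ^ a` for every `a ≤ 2`, and `d + 1` remain for `decay`.
  have hb := SchwartzMap.one_add_le_sup_seminorm_apply (𝕜 := ℂ) (m := (d + 3, 0)) le_rfl le_rfl (𝓕 Φ)
  simp only [norm_iteratedFDeriv_zero, SchwartzMap.fourier_coe] at hb
  set M := (2 : ℝ) ^ (d + 3) *
    ((Finset.Iic (d + 3, 0)).sup fun m => SchwartzMap.seminorm ℂ m.1 m.2) (𝓕 Φ) with hM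
  have hM0 : 0 ≤ M := by positivity
  refine ⟨M + 1, by positivity, fun a ha0 ha2 ζ => ?_⟩
  have h1 : (1 + ‖ζ‖) ^ (d + 3) * ‖𝓕 (fun x => (ψ x : ℂ)) ζ‖ ≤ M := hb ζ
  have h2 : ‖ζ‖ ^ a ≤ (1 + ‖ζ‖) ^ 2 := by
    calc ‖ζ‖ ^ a ≤ (1 + ‖ζ‖) ^ a := Real.rpow_le_rpow (norm_nonneg _) (by linarith) ha0
      _ ≤ (1 + ‖ζ‖) ^ (2 : ℝ) :=
          Real.rpow_le_rpow_of_exponent_le (by linarith [norm_nonneg ζ]) ha2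
      _ = _ := Real.rpow_natCast _ 2
  rw [decay, ← div_eq_mul_inv, le_div_iff₀ (by positivity)]
  calc _ ≤ ‖𝓕 (fun x => (ψ x : ℂ)) ζ‖ * (1 + ‖ζ‖) ^ 2 * (1 + ‖ζ‖) ^ (d + 1) := by gcongr
    _ = (1 + ‖ζ‖) ^ (d + 3) * ‖𝓕 (fun x => (ψ x : ℂ)) ζ‖ := by ring
    _ ≤ _ := by linarith

theorem norm_fourier_sincMollifier_le_mul {d : ℕ} {r : ℝ} {ψ : E d → ℝ} (hψ : IsMollifier r ψ)
    (ζ : E d) (i : Fin d) : ‖𝓕 (fun x => (sincMollifier ψ x : ℂ)) ζ‖ ≤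
      |Real.sinc (Real.pi * ζ i)| * ‖𝓕 (fun x => (ψ x : ℂ)) ζ‖ := by
  rw [fourier_sincMollifier hψ, norm_mul, norm_prod, mul_comm]
  refine mul_le_mul_of_nonneg_right ?_ (norm_nonneg _)
  simp only [Complex.norm_real, Real.norm_eq_abs]
  rw [← Finset.mul_prod_erase _ _ (Finset.mem_univ i)]
  exact mul_le_of_le_one_right (abs_nonneg _)
    (Finset.prod_le_one (fun _ _ => abs_nonneg _) fun _ _ => Real.abs_sinc_le_one _)

theorem norm_fourier_sincMollifier_le {d : ℕ} {r : ℝ} {ψ : E d → ℝ} (hψ : IsMollifier r ψ)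
    (ζ : E d) : ‖𝓕 (fun x => (sincMollifier ψ x : ℂ)) ζ‖ ≤ ‖𝓕 (fun x => (ψ x : ℂ)) ζ‖ := by
  rw [fourier_sincMollifier hψ, norm_mul, norm_prod]
  refine mul_le_of_le_one_right (norm_nonneg _)
    (Finset.prod_le_one (fun _ _ => norm_nonneg _) fun i _ => ?_)
  rw [Complex.norm_real]
  exact Real.abs_sinc_le_one _

/-- Shifting by an integer changes the sine only in sign, and the denominator stays at least `π /
2`. -/
theorem abs_sinc_add_int_le {x : ℝ} (hx : |x| ≤ 1 / 2) {m : ℤ} (hm : m ≠ 0) :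
    |Real.sinc (Real.pi * (x + m))| ≤ 2 * |x| := by
  have h1 : (1 : ℝ) ≤ |(m : ℝ)| := by exact_mod_cast Int.one_le_abs hm
  have h2 : 1 / 2 ≤ |x + m| := by
    have := abs_sub_abs_le_abs_sub (m : ℝ) (-x)
    rw [abs_neg, sub_neg_eq_add, add_comm] at this
    linarith
  have hne : x + m ≠ 0 := fun h => by rw [h, abs_zero] at h2; linarith
  rw [Real.sinc_of_ne_zero (mul_ne_zero Real.pi_ne_zero hne), abs_div, mul_add, mul_comm _ (m : ℝ),
    Real.sin_add_int_mul_pi, abs_mul, abs_zpow, abs_neg, abs_one, one_zpow, one_mul,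
    mul_comm (m : ℝ), ← mul_add, abs_mul, abs_of_pos Real.pi_pos,
    div_le_iff₀ (mul_pos Real.pi_pos (by linarith))]
  calc |Real.sin (Real.pi * x)| ≤ |Real.pi * x| := Real.abs_sin_le_abs
    _ = Real.pi * |x| * 1 := by rw [abs_mul, abs_of_pos Real.pi_pos, mul_one]
    _ ≤ Real.pi * |x| * (2 * |x + m|) := by
        refine mul_le_mul_of_nonneg_left (by linarith) (by positivity)
    _ = _ := by ring

/-- One coordinate with `m i ≠ 0` suffices. The gain `|ζ i|` is weakened to `‖ζ‖ ^ s`, using `s ≤ 1`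
and `|ζ i| ≤ 1 / 2`, to match the Sobolev weight. -/
theorem norm_fourier_sincMollifier_alias_le {d : ℕ} {r : ℝ} {ψ : E d → ℝ} (hψ : IsMollifier r ψ)
    {s : ℝ} (hs0 : 0 < s) (hs1 : s ≤ 1) {ζ : E d} (hζ : ζ ∈ cell 1 0) {m : Fin d → ℤ}
    (hm : m ≠ 0) :
    ‖𝓕 (fun x => (sincMollifier ψ x : ℂ)) (ζ + latticePoint 1 m)‖ ≤
      2 * ‖ζ‖ ^ s * ‖𝓕 (fun x => (ψ x : ℂ)) (ζ + latticePoint 1 m)‖ := by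
  obtain ⟨i, hi⟩ := Function.ne_iff.1 hm
  refine (norm_fourier_sincMollifier_le_mul hψ _ i).trans
    (mul_le_mul_of_nonneg_right ?_ (norm_nonneg _))
  have hx := abs_le_of_mem_cell hζ i
  rw [PiLp.add_apply, show (latticePoint 1 m : E d) i = m i by simp [latticePoint]]
  refine (abs_sinc_add_int_le hx hi).trans (mul_le_mul_of_nonneg_left ?_ zero_le_two)
  calc |ζ i| = |ζ i| ^ (1 : ℝ) := (Real.rpow_one _).symm
    _ ≤ |ζ i| ^ s :=
        Real.rpow_le_rpow_of_exponent_ge_of_imp (abs_nonneg _) (by linarith) hs1 (fun _ h => by linarith)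
    _ ≤ ‖ζ‖ ^ s := Real.rpow_le_rpow (abs_nonneg _) (PiLp.norm_apply_le ζ i) hs0.le

/-! ### The mollification error -/

theorem eLpNorm_two_sq {α : Type*} [MeasurableSpace α] (μ : Measure α) (f : α → ℂ) :
    eLpNorm f 2 μ ^ 2 = ∫⁻ x, ‖f x‖ₑ ^ 2 ∂μ := by
  have := eLpNorm_nnreal_pow_eq_lintegral (f := f) (μ := μ) (p := 2) two_ne_zero
  simpa using this

/-- A crude bound whose constant blows up as `ε → 0`; it serves integrability and `L²` membership,
not the rates. All `2s < 2` powers are charged to `ψ̂`. -/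
theorem norm_mollifiedSymbol_le {d : ℕ} {r : ℝ} {ψ : E d → ℝ} (hψ : IsMollifier r ψ) {s : ℝ}
    (hs0 : 0 < s) {C : ℝ}
    (hC : ∀ a : ℝ, 0 ≤ a → a ≤ 2 → ∀ ζ : E d,
      ‖𝓕 (fun x => (ψ x : ℂ)) ζ‖ * ‖ζ‖ ^ a ≤ C * decay ζ)
    (hs1 : s < 1) {ε : ℝ} (hε : 0 < ε) (u : Lp ℂ 2 (volume : Measure (E d))) (ξ : E d) :
    ‖mollifiedSymbol ψ s ε u ξ‖ ≤
      (2 * Real.pi / ε) ^ (2 * s) * C * (decay (ε • ξ) * ‖(𝓕 u) ξ‖) := by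
  have e : ‖(2 * Real.pi) • ξ‖ = 2 * Real.pi / ε * ‖ε • ξ‖ := by
    have := Real.pi_pos
    rw [norm_smul, norm_smul, Real.norm_of_nonneg (by positivity), Real.norm_of_nonneg hε.le]
    field_simp
  rw [mollifiedSymbol, fracSymbol, norm_mul, norm_mul, Complex.norm_of_nonneg (by positivity), e,
    Real.mul_rpow (by positivity) (norm_nonneg _)]
  have h := hC (2 * s) (by linarith) (by linarith) (ε • ξ)
  have h2 := norm_fourier_sincMollifier_le hψ (ε • ξ)
  calc _ ≤ ‖𝓕 (fun x => (ψ x : ℂ)) (ε • ξ)‖ *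
        ((2 * Real.pi / ε) ^ (2 * s) * ‖ε • ξ‖ ^ (2 * s) * ‖(𝓕 u) ξ‖) := by
        gcongr
    _ = (2 * Real.pi / ε) ^ (2 * s) *
        (‖𝓕 (fun x => (ψ x : ℂ)) (ε • ξ)‖ * ‖ε • ξ‖ ^ (2 * s)) * ‖(𝓕 u) ξ‖ := by ring
    _ ≤ (2 * Real.pi / ε) ^ (2 * s) * (C * decay (ε • ξ)) * ‖(𝓕 u) ξ‖ := by gcongr
    _ = _ := by ring

theorem enorm_le_ofReal_mul {x y : ℂ} {K c : ℝ} (hK : 0 ≤ K) (hc : 0 ≤ c)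
    (h : ‖x‖ ≤ K * (c * ‖y‖)) : ‖x‖ₑ ≤ ENNReal.ofReal K * (ENNReal.ofReal c * ‖y‖ₑ) := by
  rw [← ofReal_norm x, ← ofReal_norm y, ← ENNReal.ofReal_mul hc, ← ENNReal.ofReal_mul hK]
  exact ENNReal.ofReal_le_ofReal h

theorem integrable_mollifiedSymbol {d : ℕ} {ψ : E d → ℝ}
    (hψ : IsMollifier (Real.sqrt d / 4) ψ) {s : ℝ} (hs0 : 0 < s) (hs1 : s < 1) {ε : ℝ}
    (hε : 0 < ε) (u : Lp ℂ 2 (volume : Measure (E d))) :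
    Integrable (mollifiedSymbol ψ s ε u) := by
  obtain ⟨C, hC0, hC⟩ := hψ.exists_fourier_decay
  refine integrable_of_enorm_le_decay (inv_pos.2 hε)
    (aestronglyMeasurable_mollifiedSymbol hψ s ε u)
    (K := ENNReal.ofReal ((2 * Real.pi / ε) ^ (2 * s) * C)) ENNReal.ofReal_ne_top
    (Lp.memLp (𝓕 u)) fun ξ => ?_
  rw [inv_inv]
  have := Real.pi_pos
  exact enorm_le_ofReal_mul (by positivity) (decay_nonneg _)
    (norm_mollifiedSymbol_le hψ hs0 hC hs1 hε u ξ)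

theorem memLp_mollifiedSymbol {d : ℕ} {ψ : E d → ℝ}
    (hψ : IsMollifier (Real.sqrt d / 4) ψ) {s : ℝ} (hs0 : 0 < s) (hs1 : s < 1) {ε : ℝ}
    (hε : 0 < ε) (u : Lp ℂ 2 (volume : Measure (E d))) :
    MemLp (mollifiedSymbol ψ s ε u) 2 := by
  obtain ⟨C, hC0, hC⟩ := hψ.exists_fourier_decay
  have := Real.pi_pos
  refine (Lp.memLp (𝓕 u)).of_le_mul (c := (2 * Real.pi / ε) ^ (2 * s) * C)
    (aestronglyMeasurable_mollifiedSymbol hψ s ε u) (Filter.Eventually.of_forall fun ξ => ?_)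
  refine (norm_mollifiedSymbol_le hψ hs0 hC hs1 hε u ξ).trans ?_
  gcongr
  exact mul_le_of_le_one_left (norm_nonneg _) (decay_le_one _)

theorem memLp_mollify {d : ℕ} {ψ : E d → ℝ} (hψ : IsMollifier (Real.sqrt d / 4) ψ) {s : ℝ}
    (hs0 : 0 < s) (hs1 : s < 1) {ε : ℝ} (hε : 0 < ε) {u : Lp ℂ 2 (volume : Measure (E d))}
    {f : 𝓢'(E d, ℂ)} (hf : IsFracLaplacian s u f) : MemLp (mollify hψ hε f) 2 := by
  rw [mollify_eq_fourierInv hψ hε hf]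
  exact memLp_fourierInv (integrable_mollifiedSymbol hψ hs0 hs1 hε u)
    (memLp_mollifiedSymbol hψ hs0 hs1 hε u)

theorem fourier_toLp_mollify {d : ℕ} {ψ : E d → ℝ} (hψ : IsMollifier (Real.sqrt d / 4) ψ) {s : ℝ}
    (hs0 : 0 < s) (hs1 : s < 1) {ε : ℝ} (hε : 0 < ε) {u : Lp ℂ 2 (volume : Measure (E d))}
    {f : 𝓢'(E d, ℂ)} (hf : IsFracLaplacian s u f) (hm : MemLp (mollify hψ hε f) 2) :
    𝓕 (hm.toLp (mollify hψ hε f)) =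
      (memLp_mollifiedSymbol hψ hs0 hs1 hε u).toLp (mollifiedSymbol ψ s ε u) := by
  have e := mollify_eq_fourierInv hψ hε hf
  have hm' : MemLp (𝓕⁻ (mollifiedSymbol ψ s ε u)) 2 := e ▸ hm
  have : hm.toLp (mollify hψ hε f) = hm'.toLp (𝓕⁻ (mollifiedSymbol ψ s ε u)) := by
    congr
  rw [this]
  exact fourier_toLp_fourierInv (integrable_mollifiedSymbol hψ hs0 hs1 hε u) _ hm'

theorem sobolevNorm_sub_mollify_le {d : ℕ} {ψ : E d → ℝ}
    (hψ : IsMollifier (Real.sqrt d / 4) ψ) {s : ℝ} (hs0 : 0 < s) (hs1 : s < 1) {t : ℝ}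
    (hst : s < t) (ht : t - s ≤ 2) {ε : ℝ} (hε : 0 < ε) {u : Lp ℂ 2 (volume : Measure (E d))}
    {f : 𝓢'(E d, ℂ)} (hf : IsFracLaplacian s u f) (hm : MemLp (mollify hψ hε f) 2) :
    sobolevNorm (-s) (f - ((hm.toLp _ : Lp ℂ 2 (volume : Measure (E d))) : 𝓢'(E d, ℂ))) ≤
      ENNReal.ofReal ((2 + 2 * Real.sqrt d ^ 2) * ε ^ (t - s)) * sobolevSeminorm t u := by
  refine (sobolevNorm_le (-s) (g := fun ξ => fracSymbol s u ξ - mollifiedSymbol ψ s ε u ξ) ?_ ?_).trans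
    (eLpNorm_le_mul_eLpNorm_of_ae_le_mul (Filter.Eventually.of_forall fun ξ => ?_) 2)
  · intro φ
    have h1 : (𝓕 (f - ((hm.toLp _ : Lp ℂ 2 (volume : Measure (E d))) : 𝓢'(E d, ℂ)))) φ =
        (𝓕 f) φ - (𝓕 ((hm.toLp _ : Lp ℂ 2 (volume : Measure (E d))) : 𝓢'(E d, ℂ))) φ := rfl
    have h2 : ∫ ξ, φ ξ * mollifiedSymbol ψ s ε u ξ =
        (𝓕 ((hm.toLp _ : Lp ℂ 2 (volume : Measure (E d))) : 𝓢'(E d, ℂ))) φ := by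
      rw [Lp.fourier_toTemperedDistribution_eq, fourier_toLp_mollify hψ hs0 hs1 hε hf hm,
        Lp.toTemperedDistribution_apply]
      refine integral_congr_ae ?_
      filter_upwards [(memLp_mollifiedSymbol hψ hs0 hs1 hε u).coeFn_toLp] with ξ hξ
      rw [hξ, smul_eq_mul]
    rw [h1, hf, ← h2]
    simp_rw [mul_sub]
    refine (integral_sub (integrable_schwartz_mul_fracSymbol hs0.le u φ) ?_).symm
    exact (φ.memLp 2 volume).integrable_mul (memLp_mollifiedSymbol hψ hs0 hs1 hε u)
  · exact (aestronglyMeasurable_fracSymbol s u).sub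
      (aestronglyMeasurable_mollifiedSymbol hψ s ε u)
  · have e1 : fracSymbol s u ξ - mollifiedSymbol ψ s ε u ξ =
        (1 - 𝓕 (fun y => (sincMollifier ψ y : ℂ)) (ε • ξ)) * fracSymbol s u ξ := by
      rw [mollifiedSymbol]; ring
    rw [e1, norm_mul, norm_mul, norm_mul, Complex.norm_of_nonneg (by positivity)]
    -- The exponent `a = t - s` is what requires `t - s ≤ 2`.
    have h1 := hψ.sincMollifier.norm_one_sub_fourier_le (sub_nonneg.2 hst.le) ht (ε • ξ)
    rw [smul_comm, norm_smul ε, Real.norm_of_nonneg hε.le,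
      Real.mul_rpow hε.le (norm_nonneg _)] at h1
    have h2 := norm_sobolevWeight_mul_fracSymbol_le hs0.le u ξ
    have h3 : ‖(2 * Real.pi) • ξ‖ ^ t = ‖(2 * Real.pi) • ξ‖ ^ (t - s) * ‖(2 * Real.pi) • ξ‖ ^ s := by
      rw [← Real.rpow_add_of_nonneg (norm_nonneg _) (by linarith) hs0.le, sub_add_cancel]
    calc _ = ‖1 - 𝓕 (fun y => (sincMollifier ψ y : ℂ)) (ε • ξ)‖ *
          (‖sobolevWeight (-s) ξ‖ * ‖fracSymbol s u ξ‖) := by ring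
      _ ≤ ((2 + 2 * Real.sqrt d ^ 2) * (ε ^ (t - s) * ‖(2 * Real.pi) • ξ‖ ^ (t - s))) *
          (‖(2 * Real.pi) • ξ‖ ^ s * ‖(𝓕 u) ξ‖) := by gcongr
      _ = _ := by rw [h3]; ring

/-! ### The interpolation error -/

/-- Half of `|ω|^(2s)` at the alias is rescaled to `(2πL)^s ‖L⁻¹ • η‖^s`. The scale `(2πL)^s` joins
`‖ζ‖^s` from the sinc zeros to cancel the weight at `ξ`, and `‖L⁻¹ • η‖^s` goes to the decay of
`ψ̂`. No power of `L` survives. -/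
theorem mul_norm_alias_le {d : ℕ} {r : ℝ} {ψ : E d → ℝ} (hψ : IsMollifier r ψ) {s : ℝ}
    (hs0 : 0 < s) (hs1 : s < 1) {C : ℝ}
    (hC : ∀ a : ℝ, 0 ≤ a → a ≤ 2 → ∀ ζ : E d,
      ‖𝓕 (fun x => (ψ x : ℂ)) ζ‖ * ‖ζ‖ ^ a ≤ C * decay ζ)
    {L : ℝ} (hL : 0 < L) (u : Lp ℂ 2 (volume : Measure (E d))) {ξ : E d} (hξ : ξ ∈ cell L 0)
    {m : Fin d → ℤ} (hm : m ≠ 0) :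
    ‖sobolevWeight (-s) ξ‖ * ‖mollifiedSymbol ψ s L⁻¹ u (ξ + latticePoint L m)‖ ≤
      2 * C * (decay (L⁻¹ • (ξ + latticePoint L m)) *
        (‖(2 * Real.pi) • (ξ + latticePoint L m)‖ ^ s * ‖(𝓕 u) (ξ + latticePoint L m)‖)) := by
  set η := ξ + latticePoint L m with hη
  set ζ := L⁻¹ • ξ with hζ
  have hη' : L⁻¹ • η = ζ + latticePoint 1 m := by
    rw [hη, smul_add, inv_smul_latticePoint hL]
  have hpi := Real.pi_pos
  have scale : ∀ x : E d, ‖(2 * Real.pi) • x‖ ^ s = (2 * Real.pi * L) ^ s * ‖L⁻¹ • x‖ ^ s := by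
    intro x
    rw [← Real.mul_rpow (by positivity) (norm_nonneg _), norm_smul, norm_smul,
      Real.norm_of_nonneg (by positivity), Real.norm_of_nonneg (by positivity)]
    congr 1
    field_simp
  set W := ‖sobolevWeight (-s) ξ‖
  have hW0 : 0 ≤ W := norm_nonneg _
  have hW : W * ((2 * Real.pi * L) ^ s * ‖ζ‖ ^ s) ≤ 1 := by
    rw [hζ, ← scale]; exact norm_sobolevWeight_neg_mul_rpow_le hs0.le ξ
  have h1 := norm_fourier_sincMollifier_alias_le hψ hs0 hs1.le (inv_smul_mem_unitCell hL hξ) hm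
  rw [← hζ, ← hη'] at h1
  have h2 := hC s hs0.le (by linarith) (L⁻¹ • η)
  have hsq : ‖(2 * Real.pi) • η‖ ^ (2 * s) =
      (2 * Real.pi * L) ^ s * ‖L⁻¹ • η‖ ^ s * ‖(2 * Real.pi) • η‖ ^ s := by
    rw [← scale, two_mul s, Real.rpow_add_of_nonneg (norm_nonneg _) hs0.le hs0.le]
  rw [mollifiedSymbol, fracSymbol, norm_mul, norm_mul, Complex.norm_of_nonneg (by positivity), hsq]
  set G := ‖𝓕 (fun x => (ψ x : ℂ)) (L⁻¹ • η)‖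
  set U := ‖(2 * Real.pi) • η‖ ^ s * ‖(𝓕 u) η‖ with hU
  have hU0 : 0 ≤ U := by positivity
  calc _ ≤ W * (2 * ‖ζ‖ ^ s * G * ((2 * Real.pi * L) ^ s * ‖L⁻¹ • η‖ ^ s *
        ‖(2 * Real.pi) • η‖ ^ s * ‖(𝓕 u) η‖)) := by gcongr
    _ = W * ((2 * Real.pi * L) ^ s * ‖ζ‖ ^ s) * (2 * (G * ‖L⁻¹ • η‖ ^ s) * U) := by
        rw [hU]; ring
    _ ≤ 1 * (2 * (C * decay (L⁻¹ • η)) * U) := by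
        gcongr
    _ = _ := by ring

theorem memLp_periodize_mollifiedSymbol {d : ℕ} {ψ : E d → ℝ}
    (hψ : IsMollifier (Real.sqrt d / 4) ψ) {s : ℝ} (hs0 : 0 < s) (hs1 : s < 1) {L : ℝ}
    (hL : 0 < L) (u : Lp ℂ 2 (volume : Measure (E d))) :
    MemLp (periodize L (mollifiedSymbol ψ s L⁻¹ u)) 2 (volume.restrict (cell L 0)) := by
  obtain ⟨C, hC0, hC⟩ := hψ.exists_fourier_decay
  obtain ⟨S, hS, hS'⟩ := exists_tsum_decay_sq_le d
  refine ⟨(aestronglyMeasurable_periodize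
    (aestronglyMeasurable_mollifiedSymbol hψ s L⁻¹ u)).restrict, ?_⟩
  have hpi := Real.pi_pos
  have h := setLIntegral_mul_periodize_sq_le hS hS' hL (w := 1)
    (K := ENNReal.ofReal ((2 * Real.pi / L⁻¹) ^ (2 * s) * C)) ENNReal.ofReal_ne_top
    (h := mollifiedSymbol ψ s L⁻¹ u) (Lp.aestronglyMeasurable (𝓕 u)).enorm (fun ξ _ m => ?_)
  · simp only [Pi.one_apply, one_mul] at h
    rw [← eLpNorm_two_sq, ← eLpNorm_two_sq] at h
    have h3 := h.trans_lt (ENNReal.mul_lt_top (ENNReal.mul_lt_top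
      (ENNReal.pow_lt_top ENNReal.ofReal_lt_top) hS.lt_top)
      (ENNReal.pow_lt_top (Lp.memLp (𝓕 u)).2))
    exact (ENNReal.pow_lt_top_iff.1 h3).resolve_right two_ne_zero
  · simp only [Pi.one_apply, enorm_one, one_mul]
    exact enorm_le_ofReal_mul (by positivity) (decay_nonneg _)
      (norm_mollifiedSymbol_le hψ hs0 hC hs1 (inv_pos.2 hL) u _)

theorem le_norm_of_notMem_cell {d : ℕ} {L : ℝ} {ξ : E d} (hξ : ξ ∉ cell L 0) :
    L / 2 ≤ ‖ξ‖ := by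
  simp only [cell, mem_ofPred_eq, not_forall, Pi.zero_apply, Int.cast_zero, mem_Ioc] at hξ
  obtain ⟨i, hi⟩ := hξ
  refine le_trans ?_ (PiLp.norm_apply_le ξ i)
  rw [Real.norm_eq_abs]
  by_contra! h
  exact hi ⟨by linarith [(abs_lt.1 h).1], by linarith [(abs_lt.1 h).2]⟩

/-- Outside the cell `‖ξ‖ ≥ L / 2`, hence `‖2πξ‖ ≥ L`; the constant is one for every `t`. -/
theorem rpow_le_of_notMem_cell {d : ℕ} {L : ℝ} (hL : 0 < L) {ξ : E d} (hξ : ξ ∉ cell L 0)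
    {s t : ℝ} (hs : 0 ≤ s) (hst : s ≤ t) :
    ‖(2 * Real.pi) • ξ‖ ^ s ≤ L⁻¹ ^ (t - s) * ‖(2 * Real.pi) • ξ‖ ^ t := by
  have h1 : L ≤ ‖(2 * Real.pi) • ξ‖ := by
    rw [norm_smul, Real.norm_of_nonneg (by positivity)]
    have := le_norm_of_notMem_cell hξ
    have := Real.pi_gt_three
    nlinarith
  have h2 : 1 ≤ L⁻¹ ^ (t - s) * ‖(2 * Real.pi) • ξ‖ ^ (t - s) := by
    rw [← Real.mul_rpow (by positivity) (norm_nonneg _)]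
    refine Real.one_le_rpow ?_ (by linarith)
    rwa [inv_mul_eq_div, one_le_div hL]
  calc _ ≤ (L⁻¹ ^ (t - s) * ‖(2 * Real.pi) • ξ‖ ^ (t - s)) * ‖(2 * Real.pi) • ξ‖ ^ s :=
        le_mul_of_one_le_left (by positivity) h2
    _ = _ := by
        rw [mul_assoc, ← Real.rpow_add_of_nonneg (norm_nonneg _) (by linarith) hs, sub_add_cancel]

theorem lintegral_highFrequency_le {d : ℕ} {L : ℝ} (hL : 0 < L) {s t : ℝ} (hs : 0 ≤ s)
    (hst : s ≤ t) (u : Lp ℂ 2 (volume : Measure (E d))) :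
    ∫⁻ ξ, (indicator (cell L 0)ᶜ
      (fun ξ => ENNReal.ofReal (‖(2 * Real.pi) • ξ‖ ^ s * ‖(𝓕 u) ξ‖)) ξ) ^ 2 ≤
      (ENNReal.ofReal (L⁻¹ ^ (t - s)) * sobolevSeminorm t u) ^ 2 := by
  rw [mul_pow, sobolevSeminorm, eLpNorm_two_sq,
    ← lintegral_const_mul' _ _ (ENNReal.pow_ne_top ENNReal.ofReal_ne_top)]
  refine lintegral_mono fun ξ => ?_
  rw [← mul_pow]
  refine pow_le_pow_left₀ bot_le ?_ 2
  by_cases hξ : ξ ∈ cell L 0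
  · rw [indicator_of_notMem (by simpa using hξ)]; exact bot_le
  · rw [indicator_of_mem hξ, ← ofReal_norm, ← ENNReal.ofReal_mul (by positivity), norm_mul,
      Complex.norm_of_nonneg (by positivity), ← mul_assoc]
    exact ENNReal.ofReal_le_ofReal (mul_le_mul_of_nonneg_right
      (rpow_le_of_notMem_cell hL hξ hs hst) (norm_nonneg _))

/-- The Fourier transform of the interpolation error is small in the weighted `L²` norm. -/
theorem exists_eLpNorm_interpolationError_le {d : ℕ} {ψ : E d → ℝ}
    (hψ : IsMollifier (Real.sqrt d / 4) ψ) {s : ℝ} (hs0 : 0 < s) (hs1 : s < 1) :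
    ∃ C : ℝ, 0 < C ∧ ∀ (t : ℝ), s < t → ∀ (u : Lp ℂ 2 (volume : Measure (E d))) (L : ℝ), 0 < L →
      eLpNorm (fun ξ => sobolevWeight (-s) ξ * (mollifiedSymbol ψ s L⁻¹ u ξ -
        indicator (cell L 0) (periodize L (mollifiedSymbol ψ s L⁻¹ u)) ξ)) 2 volume ≤
      ENNReal.ofReal (C * L⁻¹ ^ (t - s)) * sobolevSeminorm t u := by
  obtain ⟨C, hC0, hC⟩ := hψ.exists_fourier_decay
  obtain ⟨S, hS, hS'⟩ := exists_tsum_decay_sq_le d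
  -- The first term pays for the aliases inside the cell, the `1` for the tail outside.
  set K : ℝ≥0∞ := ENNReal.ofReal (2 * C) ^ 2 * S + 1 with hKdef
  have hK : K ≠ ⊤ := ENNReal.add_ne_top.2
    ⟨ENNReal.mul_ne_top (ENNReal.pow_ne_top ENNReal.ofReal_ne_top) hS, ENNReal.one_ne_top⟩
  have hK1 : 1 ≤ K := le_add_self
  refine ⟨K.toReal, ENNReal.toReal_pos (one_pos.trans_le hK1).ne' hK, fun t hst u L hL => ?_⟩
  rw [ENNReal.ofReal_mul ENNReal.toReal_nonneg, ENNReal.ofReal_toReal hK, mul_assoc]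
  set R := ENNReal.ofReal (L⁻¹ ^ (t - s)) * sobolevSeminorm t u
  set h := mollifiedSymbol ψ s L⁻¹ u with hh
  -- Aliases with `m ≠ 0` of points of the cell lie outside it, so only high frequencies of `u`
  -- enter.
  set b : E d → ℝ≥0∞ := indicator (cell L 0)ᶜ
    (fun ξ => ENNReal.ofReal (‖(2 * Real.pi) • ξ‖ ^ s * ‖(𝓕 u) ξ‖)) with hbdef
  have hb : AEMeasurable b := by
    refine AEMeasurable.indicator ?_ (measurableSet_cell L 0).compl
    refine (AEMeasurable.mul (Measurable.aemeasurable ?_)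
      (Lp.aestronglyMeasurable (𝓕 u)).norm.aemeasurable).ennreal_ofReal
    fun_prop
  have hbR : ∫⁻ ξ, b ξ ^ 2 ≤ R ^ 2 := lintegral_highFrequency_le hL hs0.le hst.le u
  have hint : Integrable h := integrable_mollifiedSymbol hψ hs0 hs1 (inv_pos.2 hL) u
  have inside : ∫⁻ ξ in cell L 0, ‖sobolevWeight (-s) ξ * (h ξ -
      indicator (cell L 0) (periodize L h) ξ)‖ₑ ^ 2 ≤
      ENNReal.ofReal (2 * C) ^ 2 * S * R ^ 2 := by
    refine le_trans (le_of_eq ?_) ((setLIntegral_mul_periodize_sq_le hS hS' hL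
      (h := indicator (cell L 0)ᶜ h) (w := sobolevWeight (-s)) ENNReal.ofReal_ne_top hb
      fun ξ hξ m => ?_).trans (mul_le_mul_right hbR _))
    · refine lintegral_congr_ae ?_
      filter_upwards [ae_summable_norm_of_integrable hL hint,
        ae_restrict_mem (measurableSet_cell L 0)] with ξ hξ hmem
      rw [periodize_indicator_compl hL hmem hξ, indicator_of_mem hmem, ← enorm_neg, ← mul_neg,
        neg_sub]
    · by_cases hc : ξ + latticePoint L m ∈ cell L 0
      · rw [indicator_of_notMem (by simpa using hc)]
        simp
      · rw [hbdef, indicator_of_mem hc, indicator_of_mem hc, ← ofReal_norm, ← ofReal_norm,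
          ← ENNReal.ofReal_mul (norm_nonneg _), ← ENNReal.ofReal_mul (decay_nonneg _),
          ← ENNReal.ofReal_mul (by positivity)]
        refine ENNReal.ofReal_le_ofReal (mul_norm_alias_le hψ hs0 hs1 hC hL u hξ ?_)
        rintro rfl
        rw [latticePoint_zero, add_zero] at hc
        exact hc hξ
  have outside : ∫⁻ ξ in (cell L 0)ᶜ, ‖sobolevWeight (-s) ξ * (h ξ -
      indicator (cell L 0) (periodize L h) ξ)‖ₑ ^ 2 ≤ R ^ 2 := by
    refine le_trans ?_ hbR
    rw [← lintegral_indicator (measurableSet_cell L 0).compl]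
    refine lintegral_mono fun ξ => ?_
    by_cases hξ : ξ ∈ cell L 0
    · rw [indicator_of_notMem (by simpa using hξ)]; exact bot_le
    · rw [indicator_of_mem hξ, indicator_of_notMem hξ, sub_zero, hbdef, indicator_of_mem hξ]
      refine pow_le_pow_left₀ bot_le ?_ 2
      rw [← ofReal_norm, norm_mul]
      refine ENNReal.ofReal_le_ofReal (le_trans ?_
        (norm_sobolevWeight_mul_fracSymbol_le hs0.le u ξ))
      refine mul_le_mul_of_nonneg_left ?_ (norm_nonneg _)
      rw [hh, mollifiedSymbol, norm_mul]
      exact mul_le_of_le_one_left (norm_nonneg _) (hψ.sincMollifier.norm_fourier_le_one _)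
  refine (ENNReal.pow_le_pow_left_iff two_ne_zero).1 ?_
  rw [eLpNorm_two_sq, ← lintegral_add_compl _ (measurableSet_cell L 0)]
  calc _ ≤ ENNReal.ofReal (2 * C) ^ 2 * S * R ^ 2 + R ^ 2 := add_le_add inside outside
    _ = K * R ^ 2 := by rw [hKdef]; ring
    -- As `K ≥ 1`, replacing `K` by `K²` avoids a square root in the constant.
    _ ≤ K ^ 2 * R ^ 2 := by
        gcongr
        exact le_self_pow₀ hK1 two_ne_zero
    _ = _ := by ring

/-! ### From symbols back to the interpolant. -/

theorem hasSum_sincInterp_mollify {d : ℕ} {ψ : E d → ℝ} (hψ : IsMollifier (Real.sqrt d / 4) ψ) {s : ℝ}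
    (hs0 : 0 < s) (hs1 : s < 1) {N : ℕ} (hN : 0 < N) {u : Lp ℂ 2 (volume : Measure (E d))}
    {f : 𝓢'(E d, ℂ)} (hf : IsFracLaplacian s u f) (x : E d) :
    HasSum (fun k : Fin d → ℤ => mollify hψ (meshWidth_pos hN) f (gridPoint N k) *
        (sincBasis N k x : ℂ))
      (𝓕⁻ (indicator (cell N 0) (periodize N (mollifiedSymbol ψ s (N : ℝ)⁻¹ u))) x) := by
  have hL : (0 : ℝ) < N := Nat.cast_pos.2 hN
  have e : meshWidth N = (N : ℝ)⁻¹ := one_div _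
  rw [mollify_eq_fourierInv hψ (meshWidth_pos hN) hf, e]
  exact hasSum_sincInterp_fourierInv hN
    (integrable_mollifiedSymbol hψ hs0 hs1 (inv_pos.2 hL) u)
    (memLp_periodize_mollifiedSymbol hψ hs0 hs1 hL u) x

theorem sobolevNorm_mollify_sub_sincInterp_le {d : ℕ} {ψ : E d → ℝ}
    (hψ : IsMollifier (Real.sqrt d / 4) ψ) {s : ℝ} (hs0 : 0 < s) (hs1 : s < 1) {N : ℕ}
    (hN : 0 < N) {u : Lp ℂ 2 (volume : Measure (E d))}
    {f : 𝓢'(E d, ℂ)} (hf : IsFracLaplacian s u f) {B : ℝ≥0∞}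
    (hB : eLpNorm (fun ξ => sobolevWeight (-s) ξ * (mollifiedSymbol ψ s (N : ℝ)⁻¹ u ξ -
        indicator (cell N 0) (periodize N (mollifiedSymbol ψ s (N : ℝ)⁻¹ u)) ξ)) 2 volume ≤ B) :
    ∃ (hm : MemLp (mollify hψ (meshWidth_pos hN) f) 2 volume)
      (hp : MemLp (sincInterp N (mollify hψ (meshWidth_pos hN) f)) 2 volume),
      sobolevNorm (-s) (((hm.toLp _ - hp.toLp _ : Lp ℂ 2 (volume : Measure (E d))) :
        𝓢'(E d, ℂ))) ≤ B := by
  have hL : (0 : ℝ) < N := Nat.cast_pos.2 hN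
  have e : meshWidth N = (N : ℝ)⁻¹ := one_div _
  set P := indicator (cell N 0) (periodize N (mollifiedSymbol ψ s (N : ℝ)⁻¹ u)) with hP
  have hP2 : MemLp P 2 := (memLp_indicator_iff_restrict (measurableSet_cell _ _)).2
    (memLp_periodize_mollifiedSymbol hψ hs0 hs1 hL u)
  have hP1 : Integrable P := by
    -- The cell has finite volume, so `L²` there implies `L¹`.
    rw [hP, integrable_indicator_iff (measurableSet_cell _ _)]
    have : IsFiniteMeasure (volume.restrict (cell N 0 : Set (E d))) :=
      ⟨by rw [Measure.restrict_apply_univ]; exact (volume_cell_ne_top hL).lt_top⟩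
    exact (memLp_periodize_mollifiedSymbol hψ hs0 hs1 hL u).integrable one_le_two
  have hv : sincInterp N (mollify hψ (meshWidth_pos hN) f) = 𝓕⁻ P :=
    funext fun x => (hasSum_sincInterp_mollify hψ hs0 hs1 hN hf x).tsum_eq
  rw [hv]
  have hm := memLp_mollify hψ hs0 hs1 (meshWidth_pos hN) hf
  refine ⟨hm, memLp_fourierInv hP1 hP2, le_trans ?_ hB⟩
  have hsym := memLp_mollifiedSymbol hψ hs0 hs1 (meshWidth_pos hN) u
  refine sobolevNorm_le (-s) ?_ ?_
  · intro φ
    rw [Lp.fourier_toTemperedDistribution_eq, Lp.toTemperedDistribution_apply]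
    have h1 : 𝓕 (hm.toLp (mollify hψ (meshWidth_pos hN) f) -
        (memLp_fourierInv hP1 hP2).toLp (𝓕⁻ P)) = hsym.toLp _ - hP2.toLp P := by
      rw [← fourier_toLp_mollify hψ hs0 hs1 (meshWidth_pos hN) hf hm,
        ← fourier_toLp_fourierInv hP1 hP2 (memLp_fourierInv hP1 hP2)]
      exact map_sub (Lp.fourierTransformₗᵢ (E d) ℂ) _ _
    rw [h1]
    refine integral_congr_ae ?_
    filter_upwards [Lp.coeFn_sub (hsym.toLp _) (hP2.toLp P), hsym.coeFn_toLp,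
      hP2.coeFn_toLp] with ξ h2 h3 h4
    rw [h2, Pi.sub_apply, h3, h4, smul_eq_mul, e]
  · rw [← e]
    exact hsym.1.sub hP2.1

end SincGalerkin

theorem mainTheorem9 (d : ℕ) (hd : 0 < d) (s : ℝ) (hs0 : 0 < s) (hs1 : s < 1) :
    (∃ ψ : SincGalerkin.E d → ℝ, SincGalerkin.IsMollifier (Real.sqrt d / 4) ψ) ∧
    ∀ (ψ : SincGalerkin.E d → ℝ) (hψ : SincGalerkin.IsMollifier (Real.sqrt d / 4) ψ),
      -- the mollifier `η`
      SincGalerkin.IsMollifier (Real.sqrt d) (SincGalerkin.sincMollifier ψ) ∧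
      (∀ w : SincGalerkin.E d,
        SincGalerkin.angularFourier (SincGalerkin.sincMollifier ψ) w =
          SincGalerkin.angularFourier ψ w * ∏ i, ((Real.sinc (w i / 2) : ℝ) : ℂ)) ∧
      -- the two error bounds
      ∃ C : ℝ, 0 < C ∧
        ∀ (Ω : Set (SincGalerkin.E d)), IsOpen Ω →
        ∀ (t : ℝ), s < t →
        ∀ (u : Lp ℂ 2 (volume : Measure (SincGalerkin.E d))), SincGalerkin.MemHTilde Ω t u →
        ∀ (f : 𝓢'(SincGalerkin.E d, ℂ)), SincGalerkin.IsFracLaplacian s u f →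
          (∀ (ε : ℝ) (hε : 0 < ε), t - s ≤ 2 →
            ∃ hm : MemLp (SincGalerkin.mollify hψ hε f) 2 volume,
              SincGalerkin.sobolevNorm (-s)
                  (f - ((hm.toLp _ : Lp ℂ 2 (volume : Measure (SincGalerkin.E d))) :
                    𝓢'(SincGalerkin.E d, ℂ))) ≤
                ENNReal.ofReal (C * ε ^ (t - s)) * SincGalerkin.sobolevSeminorm t u) ∧
          (∀ (N : ℕ) (hN : 0 < N),
            (∀ x : SincGalerkin.E d, Summable fun k : Fin d → ℤ =>
              SincGalerkin.mollify hψ (SincGalerkin.meshWidth_pos hN) f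
                  (SincGalerkin.gridPoint N k) * (SincGalerkin.sincBasis N k x : ℂ)) ∧
            ∃ (hm : MemLp (SincGalerkin.mollify hψ (SincGalerkin.meshWidth_pos hN) f) 2 volume)
              (hp : MemLp (SincGalerkin.sincInterp N
                (SincGalerkin.mollify hψ (SincGalerkin.meshWidth_pos hN) f)) 2 volume),
              SincGalerkin.sobolevNorm (-s)
                  (((hm.toLp _ - hp.toLp _ : Lp ℂ 2 (volume : Measure (SincGalerkin.E d))) :
                    𝓢'(SincGalerkin.E d, ℂ))) ≤
                ENNReal.ofReal (C * SincGalerkin.meshWidth N ^ (t - s)) *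
                  SincGalerkin.sobolevSeminorm t u) := by
  refine ⟨SincGalerkin.exists_isMollifier d (by positivity), fun ψ hψ =>
    ⟨hψ.sincMollifier, SincGalerkin.angularFourier_sincMollifier hψ, ?_⟩⟩
  obtain ⟨C, hC0, hC⟩ := SincGalerkin.exists_eLpNorm_interpolationError_le hψ hs0 hs1
  have hmono : ∀ {c : ℝ} (a : ℝ) (B : ℝ≥0∞), 0 ≤ a → c ≤ max C (2 + 2 * Real.sqrt d ^ 2) →
      ENNReal.ofReal (c * a) * B ≤ ENNReal.ofReal (max C (2 + 2 * Real.sqrt d ^ 2) * a) * B :=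
    fun a B ha hc => by gcongr
  refine ⟨max C (2 + 2 * Real.sqrt d ^ 2), lt_max_of_lt_left hC0,
    fun Ω _ t hst u _ f hf => ⟨fun ε hε ht => ?_, fun N hN => ⟨fun x => ?_, ?_⟩⟩⟩
  · have hm := SincGalerkin.memLp_mollify hψ hs0 hs1 hε hf
    exact ⟨hm, (SincGalerkin.sobolevNorm_sub_mollify_le hψ hs0 hs1 hst ht hε hf hm).trans
      (hmono _ _ (by positivity) (le_max_right _ _))⟩
  -- Unconditional summability in `ℂ` is absolute convergence.
  · exact (SincGalerkin.hasSum_sincInterp_mollify hψ hs0 hs1 hN hf x).summable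
  · refine SincGalerkin.sobolevNorm_mollify_sub_sincInterp_le hψ hs0 hs1 hN hf
      ((hC t hst u N (Nat.cast_pos.2 hN)).trans ?_)
    rw [← one_div, ← SincGalerkin.meshWidth]
    exact hmono _ _ (Real.rpow_nonneg (SincGalerkin.meshWidth_pos hN).le _) (le_max_left _ _)
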